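/- \textbf{Model.} Let $M=2^L$ with $L\ge 1$. The $M$ processes are the leaves (level $0$) of a complete binary tree with root on level $L$; a known number $K$, $1\le K\le M$, of them are anomalous (targets). For every level $l\ge 0$ (the model does not depend on $M$) let $f_l(\cdot\mid\theta)$ be probability densities with respect to a $\sigma$-finite measure, $\theta_0^{(l)}$ a known parameter and $\Theta_j^{(l)}$, $j\ge1$, sets of parameters; put $\Theta_0^{(l)}=\{\theta_0^{(l)}\}$. Observations of a node on level $l$ that contains $j$ undeclared targets are independent with density $f_l(\cdot\mid\theta)$ for some unknown $\theta\in\Theta_j^{(l)}$. $D_l(\cdot\|\cdot)$ is the Kullback–Leibler divergence between the densities on level $l$. The sets $\Theta_1^{(l)}$ are finite and nonempty. Let $\Delta>0$. (AS1) $D_l(\theta_0^{(l)}\|\theta)\ge\Delta$ and $D_l(\theta\|\theta_0^{(l)})\ge\Delta$ for all $l$ and all $\theta\in\Theta_1^{(l)}$. (AS2) $K$ is known. (AS3) Declared leaves can be removed from the tree. (AS4) For all $1\le l\le L$, $1\le j\le\min(K,2^l)$ and $\varphi\in\Theta_j^{(l)}$ there is $\theta_1\in\Theta_1^{(l)}$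 with $D_l(\varphi\|\theta_1)<\infty$ and $D_l(\varphi\|\theta_0^{(l)})-D_l(\varphi\|\theta_1)\ge\Delta$. Regularity on the leaf level: the divergences between $\theta_0^{(0)}$ and the elements of $\Theta_1^{(0)}$ are finite in both directions, and $\log\frac{f_0(y\mid\theta)}{f_0(y\mid\theta_0^{(0)})}$, $\theta\in\Theta_1^{(0)}$, has a finite second moment under each of $\theta_0^{(0)}$ and the elements of $\Theta_1^{(0)}$. \textbf{$K$-target HDS}, with sampling cost $c\in(0,1)$, sample sizes $N_l\ge1$ and $N_0'\ge 0$. Let $\hat\theta_l(\cdot)$ be a (measurable) maximum likelihood estimator over $\Theta_1^{(l)}$. The following is run until $K$ leaves have been declared; after each declaration the declared leaf is removed and a new walk starts at the root. \emph{Internal test}, at a node on level $l+1$: draw $N_l$ samples $y(1),\dots,y(N_l)$ from each child that still contains an undeclared leaf, and compute the statistic $\sum_i\log\frac{f_l(y(i)\mid\hat\theta_l(y(1),\dots,y(N_l)))}{f_l(y(i)\mid\theta_0^{(l)})}$ of each of them; if one of them is strictly positive move to the child with the greater one, otherwise move to the parent (the parent of the root is the root). \emph{Leaf test}, at a leaf: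 draw $N_0'$ initial samples, then draw samples one at a time and after each of them compute $\tilde S$, the sum over all samples $y$ after the initial ones of $\log\frac{f_0(y\mid\hat\theta)}{f_0(y\mid\theta_0^{(0)})}$, where $\hat\theta$ is the estimate from all samples of this test that precede $y$; if $\tilde S>\log\frac Lc$ declare the leaf anomalous, if $\tilde S<0$ move to the parent, otherwise continue. Call $N_l$ \emph{reliable at level $p$} for $K$ if an internal test on children on level $l$ moves in the direction of the closest undeclared target (to a child containing one if there is one, else to the parent) with probability at least $p$, whatever numbers of targets (at most $K$ in total) the children contain, whatever their parameters are, and also if only one child still takes part. \textbf{Claim.} (i) For every $p<1$, $V\ge0$ and $s\in\mathbb N$ there is $n_0$ such that for all $K\ge1$ and $l\ge0$: if the inequality of (AS4) holds on level $l$ (when $l\ge1$), $|\Theta_1^{(l)}|\le s$, the divergences $D_l(\theta_0^{(l)}\|\theta)$ and $D_l(\varphi\|\theta_0^{(l)})$ are finite and the second moment of $\log\frac{f_l(\cdot\mid\theta)}{f_l(\cdot\mid\theta_0^{(l)})}$ under $\varphi$ is at most $V$ for all $\theta\in\Theta_1^{(l)}$, $\varphi\in\Theta_j^{(l)}$, $0\le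 j\le\min(K,2^l)$, then every $N_l\ge n_0$ is reliable at level $p$ for $K$. (ii) For all sufficiently large $N_0'$ (the threshold depending only on the model), every $p>\frac12$ and every $N_{\max}$ there are constants $C$ and $B$, independent of $M$, $c$, $K$ and of the $N_l$, such that, under AS1–AS4, whenever $1\le N_l\le N_{\max}$ and $N_l$ is reliable at level $p$ for $K$ for all $0\le l<L$, the expected number $\mathcal Q$ of samples of $K$-target HDS, averaged over the set of targets under an arbitrary prior on the $K$-element sets of leaves, satisfies $$\mathcal Q\le K\,C\log_2M+\frac{K\log\frac{\log_2M}{c}}{D_0(\theta_1^{(0)}\|\theta_0^{(0)})}+B .$$ Here $\theta_1^{(0)}\in\Theta_1^{(0)}$ is the parameter of the target leaves or, if they differ, any parameter with $D_0(\theta_1^{(0)}\|\theta_0^{(0)})\le D_0(\theta\|\theta_0^{(0)})$ for all parameters $\theta$ of target leaves. -/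

import Mathlib

open MeasureTheory InformationTheory
open scoped ENNReal NNReal

noncomputable section

/-- A hierarchical observation model. A node on level `l` (level `0` consists of the leaves) emits
observations with density `density l θ` with respect to `base l`, where `θ = null l` if the node
contains no anomaly and `θ ∈ anom l j` if it contains `j ≥ 1` anomalies. -/
structure HierModel (Θ Y : Type*) [MeasurableSpace Y] where
  base : ℕ → Measure Y
  sigmaFinite_base : ∀ l, SigmaFinite (base l)
  density : ℕ → Θ → Y → ℝ≥0
  measurable_density : ∀ l θ, Measurable (density l θ)
  lintegral_density : ∀ l θ, ∫⁻ y, (density l θ y : ℝ≥0∞) ∂(base l) = 1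
  null : ℕ → Θ
  anom : ℕ → ℕ → Set Θ

namespace HierModel

variable {Θ Y : Type*} [MeasurableSpace Y] (S : HierModel Θ Y)

/-- The distribution of one observation of a level `l` node with parameter `θ`. -/
def law (l : ℕ) (θ : Θ) : Measure Y :=
  (S.base l).withDensity (fun y => (S.density l θ y : ℝ≥0∞))

instance isProbabilityMeasure_law (l : ℕ) (θ : Θ) : IsProbabilityMeasure (S.law l θ) :=
  ⟨by rw [law, withDensity_apply _ MeasurableSet.univ, Measure.restrict_univ,
    S.lintegral_density]⟩

/-- The Kullback-Leibler divergence `D_l(θ ‖ θ')`. -/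
def kl (l : ℕ) (θ θ' : Θ) : ℝ≥0∞ := klDiv (S.law l θ) (S.law l θ')

/-- The parameters of a level `l` node that contains exactly `j` anomalies. -/
def paramSet (l j : ℕ) : Set Θ := if j = 0 then {S.null l} else S.anom l j

/-- `log (f_l(y | θ) / f_l(y | θ₀))`. -/
def logRatio (l : ℕ) (θ : Θ) (y : Y) : ℝ :=
  Real.log ((S.density l θ y : ℝ) / (S.density l (S.null l) y : ℝ))

/-- Anomalous and normal nodes are distinguishable at every level, with a common margin. -/
def Distinguishable (Δ : ℝ≥0) : Prop :=
  ∀ l, ∀ θ ∈ S.anom l 1, (Δ : ℝ≥0∞) ≤ S.kl l (S.null l) θ ∧ (Δ : ℝ≥0∞) ≤ S.kl l θ (S.null l)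

/-- On level `l`, a node with several (at most `K`) anomalies is closer to some node with a single
anomaly than to a normal node:  `D_l(φ ‖ θ₀) - D_l(φ ‖ θ₁) ≥ Δ`. -/
def MultiDistinguishable (Δ : ℝ≥0) (K l : ℕ) : Prop :=
  ∀ j, 1 ≤ j → j ≤ min K (2 ^ l) → ∀ φ ∈ S.anom l j, ∃ θ ∈ S.anom l 1,
    S.kl l φ θ ≠ ∞ ∧ S.kl l φ θ + (Δ : ℝ≥0∞) ≤ S.kl l φ (S.null l)

/-- On level `l` the divergences are finite, and the log-likelihood ratios have second moments
at most `V`, under every distribution of a node with at most `K` anomalies. -/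
def MomentBound (V : ℝ≥0) (K l : ℕ) : Prop :=
  (∀ θ ∈ S.anom l 1, S.kl l (S.null l) θ ≠ ∞) ∧
  ∀ j, j ≤ min K (2 ^ l) → ∀ φ ∈ S.paramSet l j,
    S.kl l φ (S.null l) ≠ ∞ ∧
    ∀ θ ∈ S.anom l 1, ∫⁻ y, ENNReal.ofReal (S.logRatio l θ y ^ 2) ∂(S.law l φ) ≤ (V : ℝ≥0∞)

/-- A maximum likelihood estimator of the anomaly parameter, with any measurable way of breaking
ties between maximizers. -/
structure MLE where
  est : ℕ → List Y → Θ
  mem : ∀ (l : ℕ) (ys : List Y), est l ys ∈ S.anom l 1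
  le_est : ∀ (l : ℕ) (ys : List Y), ∀ θ ∈ S.anom l 1,
    (ys.map (S.density l θ)).prod ≤ (ys.map (S.density l (est l ys))).prod
  measurableSet_est : ∀ l n θ, MeasurableSet {y : Fin n → Y | est l (List.ofFn y) = θ}

variable {S} (E : S.MLE)

/-- The generalized log-likelihood ratio of a sample from a level `l` node. It vanishes on the
empty sample. -/
def gllr (l : ℕ) (ys : List Y) : ℝ := (ys.map (S.logRatio l (E.est l ys))).sum

/-- The adaptive log-likelihood ratio of a sample from a leaf, whose first `N₀` entries only
serve to initialize the delayed maximum likelihood estimate. -/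
def allr (N₀ : ℕ) (ys : List Y) : ℝ :=
  ∑ i : Fin ys.length,
    if N₀ ≤ (i : ℕ) then S.logRatio 0 (E.est 0 (ys.take i)) (ys.get i) else 0

end HierModel

/-- The possible moves of the random walk after an internal test. -/
inductive HDSMove where
  | left : HDSMove
  | right : HDSMove
  | parent : HDSMove

/-- The outcome of an internal test from the statistics of the two children: the child with the
greater statistic if at least one is strictly positive, and the parent otherwise. A child that is
no longer part of the tree has the statistic `0`, so that it is never chosen. -/
def internalMove (gL gR : ℝ) : HDSMove :=
  open Classical in
  if gL ≤ 0 ∧ gR ≤ 0 then .parent else if gR ≤ gL then .left else .right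

/-- The move leads towards the closest anomaly, when the two children contain `jL` and `jR`
anomalies. -/
def HDSMove.Correct (jL jR : ℕ) : HDSMove → Prop
  | .left => 0 < jL
  | .right => 0 < jR
  | .parent => jL = 0 ∧ jR = 0

/-- `n` samples per child on level `l` make an internal test reliable at confidence level `p`: it
moves towards the closest anomaly with probability at least `p`, whatever number of anomalies
(at most `K` in total) the two children contain and whatever their parameters are. `aL` and `aR`
tell whether the left and the right child are still part of the tree. -/
def HierModel.ReliableTest {Θ Y : Type*} [MeasurableSpace Y] {S : HierModel Θ Y} (E : S.MLE)
    (K l n : ℕ) (p : ℝ) : Prop :=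
  ∀ (aL aR : Bool) (jL jR : ℕ) (φL φR : Θ),
    (aL = true ∨ aR = true) → (aL = false → jL = 0) → (aR = false → jR = 0) →
    jL ≤ 2 ^ l → jR ≤ 2 ^ l → jL + jR ≤ K →
    φL ∈ S.paramSet l jL → φR ∈ S.paramSet l jR →
    ENNReal.ofReal p ≤
      ((Measure.pi (fun _ : Fin (if aL then n else 0) => S.law l φL)).prod
        (Measure.pi (fun _ : Fin (if aR then n else 0) => S.law l φR)))
        {x | (internalMove (HierModel.gllr E l (List.ofFn x.1))
          (HierModel.gllr E l (List.ofFn x.2))).Correct jL jR}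

/-- The inputs of the search: number `K` of targets, height `L` of the tree (it has `M = 2 ^ L`
leaves), sampling cost `c`, sample sizes `N l` of the internal tests on children on level `l`, and
number `N₀` of initial samples of a leaf test. -/
structure HDSParams where
  K : ℕ
  L : ℕ
  c : ℝ
  N : ℕ → ℕ
  N₀ : ℕ

/-- The state of the search between two samples: the leaves declared so far, the node
`(level, index)` inspected by the random walk, and the samples of the current local test. The
children of `(l + 1, i)` are `(l, 2 * i)` and `(l, 2 * i + 1)`, the leaves below `(l, i)` are the
`m` with `m / 2 ^ l = i`, and the root is `(L, 0)`. -/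
structure HDSState (Y : Type*) where
  removed : Finset ℕ
  level : ℕ
  index : ℕ
  data : List Y

namespace HDSParams

variable {Θ Y : Type*} [MeasurableSpace Y] {S : HierModel Θ Y} (A : HDSParams) (E : S.MLE)

/-- The node `(l, i)` still contains an undeclared leaf. -/
def Alive (R : Finset ℕ) (l i : ℕ) : Prop := ∃ m < 2 ^ A.L, m ∉ R ∧ m / 2 ^ l = i

/-- The number of samples that an internal test takes from the child `(l, i)`. -/
def childSize (R : Finset ℕ) (l i : ℕ) : ℕ :=
  open Classical in
  if A.Alive R l i then A.N l else 0

/-- A random walk that starts at the root. -/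
def start (R : Finset ℕ) : HDSState Y := ⟨R, A.L, 0, []⟩

/-- The walk arrives at the parent of `(l, i)`; the parent of the root is the root. -/
def toParent (R : Finset ℕ) (l i : ℕ) : HDSState Y :=
  if l < A.L then ⟨R, l + 1, i / 2, []⟩ else ⟨R, l, i, []⟩

/-- The selection rule: the node from which the next sample is taken. -/
def query (s : HDSState Y) : ℕ × ℕ :=
  match s.level with
  | 0 => (0, s.index)
  | l + 1 =>
    if s.data.length < A.childSize s.removed l (2 * s.index) then (l, 2 * s.index)
    else (l, 2 * s.index + 1)

/-- A leaf test on leaf `i` whose samples so far are `d`. -/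
def leafStep (R : Finset ℕ) (i : ℕ) (d : List Y) : HDSState Y :=
  open Classical in
  if d.length ≤ A.N₀ then ⟨R, 0, i, d⟩
  else if Real.log ((A.L : ℝ) / A.c) < HierModel.allr E A.N₀ d then A.start (insert i R)
  else if HierModel.allr E A.N₀ d < 0 then A.toParent R 0 i
  else ⟨R, 0, i, d⟩

/-- An internal test on the node `(l + 1, i)` whose samples so far are `d`, those of the left child
first. -/
def internalStep (R : Finset ℕ) (l i : ℕ) (d : List Y) : HDSState Y :=
  if d.length < A.childSize R l (2 * i) + A.childSize R l (2 * i + 1) then ⟨R, l + 1, i, d⟩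
  else
    match internalMove (HierModel.gllr E l (d.take (A.childSize R l (2 * i))))
        (HierModel.gllr E l (d.drop (A.childSize R l (2 * i)))) with
    | .left => ⟨R, l, 2 * i, []⟩
    | .right => ⟨R, l, 2 * i + 1, []⟩
    | .parent => A.toParent R (l + 1) i

/-- The state after the next sample `y`. -/
def update (s : HDSState Y) (y : Y) : HDSState Y :=
  match s.level with
  | 0 => A.leafStep E s.removed s.index (s.data ++ [y])
  | l + 1 => A.internalStep E s.removed l s.index (s.data ++ [y])

/-- The state after `t` samples. Here `ω t (R, l, i)` is the value that a sample at time `t` of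
the node `(l, i)` has if the leaves in `R` have been removed from the tree. -/
def state (ω : ℕ → Finset ℕ × ℕ × ℕ → Y) : ℕ → HDSState Y
  | 0 => A.start ∅
  | t + 1 => A.update E (state ω t) (ω t ((state ω t).removed, A.query (state ω t)))

/-- The stopping time: the number of samples taken until `K` leaves have been declared. -/
def stopTime (ω : ℕ → Finset ℕ × ℕ × ℕ → Y) : ℝ≥0∞ :=
  ⨅ (t : ℕ) (_ : A.K ≤ (A.state E ω t).removed.card), (t : ℝ≥0∞)

/-- The joint law of all potential observations: they are independent, and those of the node
`(l, i)` after removal of `R` have the law with parameter `param R l i`. -/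
def obsLaw (S : HierModel Θ Y) (param : Finset ℕ → ℕ → ℕ → Θ) :
    Measure (ℕ → Finset ℕ × ℕ × ℕ → Y) :=
  Measure.infinitePi (fun _ : ℕ =>
    Measure.infinitePi (fun a : Finset ℕ × ℕ × ℕ => S.law a.2.1 (param a.1 a.2.1 a.2.2)))

/-- The possible sets of targets. -/
def hypotheses : Finset (Finset ℕ) := (Finset.range (2 ^ A.L)).powersetCard A.K

/-- The expected number of samples, averaged over the set `H` of targets with respect to `prior`.
The parameters of the nodes under `H` are given by `param H`. -/
def sampleComplexity (prior : Finset ℕ → ℝ≥0∞)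
    (param : Finset ℕ → Finset ℕ → ℕ → ℕ → Θ) : ℝ≥0∞ :=
  ∑ H ∈ A.hypotheses, prior H * ∫⁻ ω, A.stopTime E ω ∂(obsLaw S (param H))

/-- The parameters of all nodes below the root agree with the number of undeclared targets (elements
of `H` that have not been removed) in them. -/
def Admissible (S : HierModel Θ Y) (H : Finset ℕ) (param : Finset ℕ → ℕ → ℕ → Θ) : Prop :=
  ∀ R l i, l < A.L →
    param R l i ∈ S.paramSet l ((H \ R).filter (fun m => m / 2 ^ l = i)).card

end HDSParams

end

/-! For the first claim it suffices that the statistic of each child has the right sign: if both are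
positive, both children contain targets and either choice is correct. For a normal child the
estimate takes finitely many values, each with a log-likelihood ratio of mean at most -Δ, so
Chebyshev's inequality and a union bound apply. For an anomalous child the maximum dominates the sum
for the single parameter θ₁ given by AS4 (on leaves: the true parameter, by AS1), whose mean D(φ‖θ₀)
- D(φ‖θ₁) is at least Δ. Both error probabilities are O(1/n), with constants depending only on s, V
and Δ.

The second claim is a potential argument: a value attached to the states that falls by at least one
per sample on average bounds the expected number of samples (`HDSParams.lintegral_truncTime_le`). On
arrival at a node, with R removed, the value is (K - |R| - 1)(α + aL) + α + a·dist, where dist is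
the distance to the closest remaining target, a is the price of one level, and α = b/D + A with b =
log(L/c) is the price of testing a target. A reliable internal test lowers the distance term by at
least a(2p - 1) on average, which pays for its at most 2·N_max samples. A false declaration does no
harm to this count, since it too uses up one of the K declarations; and before the K-th declaration
some target always remains.

Leaf tests need finer potentials. On a normal leaf the sum has negative drift, so the test ends
after bounded expected time (`HierModel.exists_leafPotential_null`). On a target
(`HierModel.exists_leafPotential_target`) three effects are combined: a concave passage potential
gives b/D plus a constant despite the overshoot; the affinities of wrong parameters give a geometric
bound on the expected number of wrong estimates, made small by the initial samples; and min(1,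
exp(-sum)) bounds the risk of rejection. A rejection leaves the whole passage still to be done,
which the passage potential already pays for, so A can be chosen independently of b. This gives the
leading term K·b/D exactly. -/

namespace HierModel

variable {Θ Y : Type*} [MeasurableSpace Y] (S : HierModel Θ Y)

/-! ### Densities, divergences and means of log-likelihood ratios -/

lemma measurable_coe_density (l : ℕ) (θ : Θ) :
    Measurable fun y => (S.density l θ y : ℝ) :=
  (S.measurable_density l θ).coe_nnreal_real

lemma measurable_logRatio (l : ℕ) (θ : Θ) : Measurable (S.logRatio l θ) :=
  Real.measurable_log.comp
    ((S.measurable_coe_density l θ).div (S.measurable_coe_density l (S.null l)))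

lemma ae_law_iff {l : ℕ} {θ : Θ} {p : Y → Prop} :
    (∀ᵐ y ∂(S.law l θ), p y) ↔ ∀ᵐ y ∂(S.base l), S.density l θ y ≠ 0 → p y := by
  rw [law, ae_withDensity_iff (S.measurable_density l θ).coe_nnreal_ennreal]
  simp

lemma ae_density_ne_zero (l : ℕ) (θ : Θ) : ∀ᵐ y ∂(S.law l θ), S.density l θ y ≠ 0 :=
  S.ae_law_iff.2 (Filter.Eventually.of_forall fun _ h => h)

lemma ae_density_ne_zero_of_ac {l : ℕ} {φ θ : Θ} (h : S.law l φ ≪ S.law l θ) :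
    ∀ᵐ y ∂(S.law l φ), S.density l θ y ≠ 0 :=
  h.ae_le (S.ae_density_ne_zero l θ)

lemma lintegral_law (l : ℕ) (θ : Θ) (g : Y → ℝ≥0∞) :
    ∫⁻ y, g y ∂(S.law l θ) = ∫⁻ y, (S.density l θ y : ℝ≥0∞) * g y ∂(S.base l) := by
  rw [law, lintegral_withDensity_eq_lintegral_mul_non_measurable _
    (S.measurable_density l θ).coe_nnreal_ennreal (by simp)]
  rfl

lemma law_eq_withDensity {l : ℕ} {φ θ : Θ} (h : S.law l φ ≪ S.law l θ) :
    S.law l φ = (S.law l θ).withDensity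
      (fun y => (S.density l φ y : ℝ≥0∞) / (S.density l θ y : ℝ≥0∞)) := by
  have hb : ∀ᵐ y ∂(S.base l), S.density l φ y ≠ 0 → S.density l θ y ≠ 0 :=
    S.ae_law_iff.1 (S.ae_density_ne_zero_of_ac h)
  have hm := (S.measurable_density l φ).coe_nnreal_ennreal
  have hm' := (S.measurable_density l θ).coe_nnreal_ennreal
  refine Eq.trans (withDensity_congr_ae ?_) (withDensity_mul _ hm' (hm.div hm'))
  filter_upwards [hb] with y hy
  by_cases h0 : S.density l θ y = 0
  · have : S.density l φ y = 0 := by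
      by_contra h1; exact hy h1 h0
    simp [this]
  · simp only [Pi.mul_apply]
    rw [ENNReal.mul_div_cancel (by simpa using h0) (by simp)]

lemma llr_law {l : ℕ} {φ θ : Θ} (h : S.law l φ ≪ S.law l θ) :
    llr (S.law l φ) (S.law l θ) =ᵐ[S.law l φ]
      fun y => Real.log ((S.density l φ y : ℝ) / (S.density l θ y : ℝ)) := by
  have hm := (S.measurable_density l φ).coe_nnreal_ennreal
  have hm' := (S.measurable_density l θ).coe_nnreal_ennreal
  have h1 : (S.law l φ).rnDeriv (S.law l θ) =ᵐ[S.law l θ]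
      fun y => (S.density l φ y : ℝ≥0∞) / (S.density l θ y : ℝ≥0∞) := by
    conv_lhs => rw [S.law_eq_withDensity h]
    exact Measure.rnDeriv_withDensity _ (hm.div hm')
  filter_upwards [h.ae_le h1] with y hy
  rw [llr, hy]
  simp [ENNReal.toReal_div]

/-- Translates finiteness of the abstract divergence into statements about the given densities.
Absolute continuity ensures that later quotients and logarithms are not default values, almost
surely. -/
lemma kl_ne_top_imp {l : ℕ} {φ θ : Θ} (h : S.kl l φ θ ≠ ∞) :
    S.law l φ ≪ S.law l θ ∧
    Integrable (fun y => Real.log ((S.density l φ y : ℝ) / (S.density l θ y : ℝ))) (S.law l φ) ∧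
    ∫ y, Real.log ((S.density l φ y : ℝ) / (S.density l θ y : ℝ)) ∂(S.law l φ)
      = (S.kl l φ θ).toReal := by
  obtain ⟨hac, hint⟩ := klDiv_ne_top_iff.1 h
  have he := S.llr_law hac
  refine ⟨hac, hint.congr he, ?_⟩
  rw [kl, toReal_klDiv_of_measure_eq hac (by simp)]
  exact (integral_congr_ae he).symm

/-- Under the distribution of a normal node, the log-likelihood ratio has mean `-D(θ₀ ‖ θ)`. -/
lemma integral_logRatio_null {l : ℕ} {θ : Θ} (h : S.kl l (S.null l) θ ≠ ∞) :
    ∫ y, S.logRatio l θ y ∂(S.law l (S.null l)) = -(S.kl l (S.null l) θ).toReal := by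
  rw [← (S.kl_ne_top_imp h).2.2, ← integral_neg]
  refine integral_congr_ae (Filter.Eventually.of_forall fun y => ?_)
  simp only [logRatio]
  rw [← Real.log_inv, inv_div]

/-- The mean of the log-likelihood ratio of `θ` under `φ` is `D(φ ‖ θ₀) - D(φ ‖ θ)`. -/
lemma integral_logRatio {l : ℕ} {φ θ : Θ} (h0 : S.kl l φ (S.null l) ≠ ∞) (h : S.kl l φ θ ≠ ∞) :
    ∫ y, S.logRatio l θ y ∂(S.law l φ)
      = (S.kl l φ (S.null l)).toReal - (S.kl l φ θ).toReal := by
  obtain ⟨a0, i0, e0⟩ := S.kl_ne_top_imp h0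
  obtain ⟨a1, i1, e1⟩ := S.kl_ne_top_imp h
  rw [← e0, ← e1, ← integral_sub i0 i1]
  refine integral_congr_ae ?_
  filter_upwards [S.ae_density_ne_zero l φ, S.ae_density_ne_zero_of_ac a0,
    S.ae_density_ne_zero_of_ac a1] with y h1 h2 h3
  have h1' : (S.density l φ y : ℝ) ≠ 0 := by simpa using h1
  have h2' : (S.density l (S.null l) y : ℝ) ≠ 0 := by simpa using h2
  have h3' : (S.density l θ y : ℝ) ≠ 0 := by simpa using h3
  rw [logRatio, Real.log_div h3' h2', Real.log_div h1' h2', Real.log_div h1' h3']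
  ring

lemma memLp_logRatio {l : ℕ} {φ θ : Θ} {V : ℝ≥0}
    (h : ∫⁻ y, ENNReal.ofReal (S.logRatio l θ y ^ 2) ∂(S.law l φ) ≤ V) :
    MemLp (S.logRatio l θ) 2 (S.law l φ) := by
  rw [memLp_two_iff_integrable_sq (S.measurable_logRatio l θ).aestronglyMeasurable]
  refine ⟨((S.measurable_logRatio l θ).pow_const 2).aestronglyMeasurable, ?_⟩
  rw [hasFiniteIntegral_iff_ofReal (Filter.Eventually.of_forall fun y => sq_nonneg _)]
  exact h.trans_lt ENNReal.coe_lt_top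

lemma integral_sq_logRatio_le {l : ℕ} {φ θ : Θ} {V : ℝ≥0}
    (h : ∫⁻ y, ENNReal.ofReal (S.logRatio l θ y ^ 2) ∂(S.law l φ) ≤ V) :
    ∫ y, S.logRatio l θ y ^ 2 ∂(S.law l φ) ≤ V := by
  rw [integral_eq_lintegral_of_nonneg_ae (Filter.Eventually.of_forall fun y => sq_nonneg _)
    ((S.measurable_logRatio l θ).pow_const 2).aestronglyMeasurable]
  exact ENNReal.toReal_le_of_le_ofReal V.2 (by simpa using h)

end HierModel

/-! ### Reliability of the internal tests -/

/-- The comparison of the two statistics matters only when both are positive, and then both children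
contain targets. -/
lemma internalMove_correct {jL jR : ℕ} {gL gR : ℝ} (hL : 0 < gL ↔ 0 < jL) (hR : 0 < gR ↔ 0 < jR) :
    (internalMove gL gR).Correct jL jR := by
  unfold internalMove
  split_ifs with h1 h2
  · constructor
    · by_contra h
      exact absurd (hL.2 (Nat.pos_of_ne_zero h)) (not_lt.2 h1.1)
    · by_contra h
      exact absurd (hR.2 (Nat.pos_of_ne_zero h)) (not_lt.2 h1.2)
  · exact hL.1 (by by_contra h; exact h1 ⟨by linarith, by linarith⟩)
  · exact hR.1 (by by_contra h; exact h1 ⟨by linarith, by linarith⟩)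

/-- Chebyshev's inequality for the sum of a sample. -/
lemma measure_sum_deviation_le {Y : Type*} [MeasurableSpace Y] (μ : Measure Y)
    [IsProbabilityMeasure μ] {Z : Y → ℝ} (hZ : MemLp Z 2 μ) {V Δ : ℝ} (hΔ : 0 < Δ)
    (hV : ∫ y, Z y ^ 2 ∂μ ≤ V) {n : ℕ} (hn : 0 < n) :
    Measure.pi (fun _ : Fin n => μ) {x | n * Δ ≤ |∑ i, Z (x i) - n * ∫ y, Z y ∂μ|}
      ≤ ENNReal.ofReal (V / (n * Δ ^ 2)) := by
  have hn' : (0 : ℝ) < n := by exact_mod_cast hn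
  have hLp : ∀ i : Fin n, MemLp (fun x : Fin n → Y => Z (x i)) 2 (Measure.pi fun _ : Fin n => μ) :=
    fun i => hZ.comp_measurePreserving (measurePreserving_eval (fun _ : Fin n => μ) i)
  have hW : MemLp (fun x : Fin n → Y => ∑ i, Z (x i)) 2 (Measure.pi fun _ : Fin n => μ) :=
    memLp_finsetSum _ fun i _ => hLp i
  have hE : ∫ x, ∑ i, Z (x i) ∂(Measure.pi fun _ : Fin n => μ) = n * ∫ y, Z y ∂μ := by
    rw [integral_finsetSum _ fun i _ => (hLp i).integrable (by norm_num)]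
    have : ∀ i : Fin n, ∫ x : Fin n → Y, Z (x i) ∂(Measure.pi fun _ : Fin n => μ)
        = ∫ y, Z y ∂μ := fun i =>
      integral_comp_eval (μ := fun _ : Fin n => μ) (i := i) hZ.aestronglyMeasurable
    simp [this]
  have hVar : ProbabilityTheory.variance (fun x : Fin n → Y => ∑ i, Z (x i))
      (Measure.pi fun _ : Fin n => μ) ≤ n * V := by
    have := ProbabilityTheory.variance_sum_pi (μ := fun _ : Fin n => μ) (X := fun _ => Z)
      (fun _ => hZ)
    have e : (∑ i, fun ω : Fin n → Y => Z (ω i)) = fun x => ∑ i, Z (x i) := by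
      ext x; simp
    rw [e] at this
    rw [this]
    simp only [Finset.sum_const, Finset.card_univ, Fintype.card_fin, nsmul_eq_mul]
    gcongr
    exact (ProbabilityTheory.variance_le_expectation_sq hZ.aestronglyMeasurable).trans hV
  have := ProbabilityTheory.meas_ge_le_variance_div_sq hW (c := n * Δ) (by positivity)
  rw [hE] at this
  refine this.trans (ENNReal.ofReal_le_ofReal ?_)
  rw [div_le_div_iff₀ (by positivity) (by positivity)]
  calc _ ≤ (n * V) * (n * Δ ^ 2) := by gcongr
    _ = _ := by ring

namespace HierModel

variable {Θ Y : Type*} [MeasurableSpace Y] {S : HierModel Θ Y} (E : S.MLE)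

lemma gllr_ofFn (l : ℕ) {n : ℕ} (x : Fin n → Y) :
    gllr E l (List.ofFn x) = ∑ i, S.logRatio l (E.est l (List.ofFn x)) (x i) := by
  rw [gllr, List.map_ofFn, List.sum_ofFn]
  rfl

lemma gllr_nil (l : ℕ) : gllr E l [] = 0 := rfl

lemma sum_logRatio_eq {l : ℕ} {θ : Θ} {n : ℕ} {x : Fin n → Y}
    (h : ∀ i, S.density l θ (x i) ≠ 0) (h0 : ∀ i, S.density l (S.null l) (x i) ≠ 0) :
    ∑ i, S.logRatio l θ (x i) =
      Real.log (∏ i, (S.density l θ (x i) : ℝ)) -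
      ∑ i, Real.log (S.density l (S.null l) (x i)) := by
  rw [Real.log_prod (fun i _ => by simpa using h i), ← Finset.sum_sub_distrib]
  refine Finset.sum_congr rfl fun i _ => ?_
  rw [logRatio, Real.log_div (by simpa using h i) (by simpa using h0 i)]

/-- The generalized log-likelihood ratio dominates that of every single parameter. -/
lemma sum_logRatio_le_gllr {l : ℕ} {θ : Θ} (hθ : θ ∈ S.anom l 1) {n : ℕ} {x : Fin n → Y}
    (h : ∀ i, S.density l θ (x i) ≠ 0) (h0 : ∀ i, S.density l (S.null l) (x i) ≠ 0) :
    ∑ i, S.logRatio l θ (x i) ≤ gllr E l (List.ofFn x) := by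
  have hle := E.le_est l (List.ofFn x) θ hθ
  rw [List.map_ofFn, List.prod_ofFn, List.map_ofFn, List.prod_ofFn] at hle
  simp only [Function.comp] at hle
  have hpos : 0 < ∏ i, S.density l θ (x i) :=
    Finset.prod_pos fun i _ => pos_iff_ne_zero.2 (h i)
  -- A positive likelihood under θ forces a positive one under the maximizer, so the logarithms
  -- below are genuine.
  have hest : ∀ i, S.density l (E.est l (List.ofFn x)) (x i) ≠ 0 := fun i =>
    (Finset.prod_ne_zero_iff.1 (hpos.trans_le hle).ne') i (Finset.mem_univ i)
  rw [gllr_ofFn, sum_logRatio_eq h h0, sum_logRatio_eq hest h0]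
  refine sub_le_sub_right (Real.log_le_log ?_ ?_) _
  · exact_mod_cast hpos
  · exact_mod_cast hle

/-- The estimate depends on the sample, so its sum is not one of independent terms. A positive
statistic does force one of finitely many fixed-parameter sums to exceed its mean by nΔ; hence the
factor s. -/
lemma measure_gllr_pos_le {Δ V : ℝ} (hΔ : 0 < Δ) {l s : ℕ} (hf : (S.anom l 1).Finite)
    (hs : (S.anom l 1).ncard ≤ s)
    (hL2 : ∀ θ ∈ S.anom l 1, MemLp (S.logRatio l θ) 2 (S.law l (S.null l)))
    (hV : ∀ θ ∈ S.anom l 1, ∫ y, S.logRatio l θ y ^ 2 ∂(S.law l (S.null l)) ≤ V)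
    (hm : ∀ θ ∈ S.anom l 1, ∫ y, S.logRatio l θ y ∂(S.law l (S.null l)) ≤ -Δ)
    {n : ℕ} (hn : 0 < n) :
    Measure.pi (fun _ : Fin n => S.law l (S.null l)) {x | 0 < gllr E l (List.ofFn x)}
      ≤ ENNReal.ofReal (s * (V / (n * Δ ^ 2))) := by
  classical
  set μ := S.law l (S.null l)
  have hsub : {x : Fin n → Y | 0 < gllr E l (List.ofFn x)} ⊆ ⋃ θ ∈ hf.toFinset,
      {x | n * Δ ≤ |∑ i, S.logRatio l θ (x i) - n * ∫ y, S.logRatio l θ y ∂μ|} := by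
    intro x hx
    have hmem := E.mem l (List.ofFn x)
    simp only [Set.mem_iUnion]
    refine ⟨_, hf.mem_toFinset.2 hmem, ?_⟩
    have h1 := hm _ hmem
    rw [Set.mem_ofPred_eq, gllr_ofFn] at hx
    have h2 : (n : ℝ) * ∫ y, S.logRatio l (E.est l (List.ofFn x)) y ∂μ ≤ n * (-Δ) := by gcongr
    change (n : ℝ) * Δ ≤ |_|
    refine le_trans ?_ (le_abs_self _)
    linarith
  refine (measure_mono hsub).trans ((measure_biUnion_finset_le _ _).trans ?_)
  refine (Finset.sum_le_sum fun θ hθ => measure_sum_deviation_le μ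
    (hL2 θ (hf.mem_toFinset.1 hθ)) hΔ (hV θ (hf.mem_toFinset.1 hθ)) hn).trans ?_
  rw [Finset.sum_const, nsmul_eq_mul, ENNReal.ofReal_mul (by positivity), ENNReal.ofReal_natCast]
  gcongr
  rwa [← Set.ncard_eq_toFinset_card _ hf]

/-- The statistic dominates the sum for the fixed θ, so Chebyshev's inequality for this one sum is
enough. The domination holds only where the densities of θ and of the null parameter are nonzero,
hence the almost sure comparison of events. -/
lemma measure_gllr_nonpos_le {Δ V : ℝ} (hΔ : 0 < Δ) {l : ℕ} {φ θ : Θ} (hθ : θ ∈ S.anom l 1)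
    (h0 : S.kl l φ (S.null l) ≠ ∞) (h1 : S.kl l φ θ ≠ ∞)
    (hL2 : MemLp (S.logRatio l θ) 2 (S.law l φ))
    (hV : ∫ y, S.logRatio l θ y ^ 2 ∂(S.law l φ) ≤ V)
    (hm : Δ ≤ ∫ y, S.logRatio l θ y ∂(S.law l φ)) {n : ℕ} (hn : 0 < n) :
    Measure.pi (fun _ : Fin n => S.law l φ) {x | gllr E l (List.ofFn x) ≤ 0}
      ≤ ENNReal.ofReal (V / (n * Δ ^ 2)) := by
  set μ := S.law l φ
  refine le_trans (measure_mono_ae ?_) (measure_sum_deviation_le μ hL2 hΔ hV hn)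
  have hae : ∀ {p : Y → Prop}, (∀ᵐ y ∂μ, p y) →
      ∀ᵐ x ∂(Measure.pi fun _ : Fin n => μ), ∀ i, p (x i) := fun hp =>
    ae_all_iff.2 fun i =>
      (measurePreserving_eval (fun _ : Fin n => μ) i).quasiMeasurePreserving.ae hp
  filter_upwards [hae (S.ae_density_ne_zero_of_ac (S.kl_ne_top_imp h0).1),
    hae (S.ae_density_ne_zero_of_ac (S.kl_ne_top_imp h1).1)] with x hx0 hx1 hx
  have hle := sum_logRatio_le_gllr E hθ hx1 hx0
  have h2 : (n : ℝ) * Δ ≤ n * ∫ y, S.logRatio l θ y ∂μ := by gcongr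
  have hx' : gllr E l (List.ofFn x) ≤ 0 := hx
  change (n : ℝ) * Δ ≤ |_|
  rw [abs_sub_comm]
  refine le_trans ?_ (le_abs_self _)
  linarith

/-- The probability that the statistic of a child has the wrong sign. -/
lemma measure_wrong_sign_le {Δ V : ℝ≥0} (hΔ : 0 < Δ) (hdist : S.Distinguishable Δ)
    {l s K : ℕ} (hf : (S.anom l 1).Finite) (hs : (S.anom l 1).ncard ≤ s)
    (hmult : 1 ≤ l → S.MultiDistinguishable Δ K l) (hmom : S.MomentBound V K l)
    {j : ℕ} (hj : j ≤ 2 ^ l) (hjK : j ≤ K) {φ : Θ} (hφ : φ ∈ S.paramSet l j) {n : ℕ}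
    (hn : 0 < n) :
    Measure.pi (fun _ : Fin n => S.law l φ) {x | ¬ (0 < gllr E l (List.ofFn x) ↔ 0 < j)}
      ≤ ENNReal.ofReal (s * ((V : ℝ) / (n * (Δ : ℝ) ^ 2))) := by
  have hΔ' : (0 : ℝ) < Δ := by exact_mod_cast hΔ
  obtain ⟨hk0, hsq⟩ := hmom.2 j (le_min hjK hj) φ hφ
  rcases Nat.eq_zero_or_pos j with rfl | hj0
  · have hφ' : φ = S.null l := by simpa [paramSet] using hφ
    subst hφ'
    simp only [lt_irrefl, iff_false, not_not]
    refine measure_gllr_pos_le E hΔ' hf hs (fun θ hθ => S.memLp_logRatio (hsq θ hθ))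
      (fun θ hθ => S.integral_sq_logRatio_le (hsq θ hθ)) (fun θ hθ => ?_) hn
    rw [S.integral_logRatio_null (hmom.1 θ hθ), neg_le_neg_iff]
    exact (ENNReal.ofReal_le_iff_le_toReal (hmom.1 θ hθ)).1 (by simpa using (hdist l θ hθ).1)
  · have hφ' : φ ∈ S.anom l j := by simpa [paramSet, hj0.ne'] using hφ
    have key : ∃ θ ∈ S.anom l 1, S.kl l φ θ ≠ ∞ ∧
        S.kl l φ θ + (Δ : ℝ≥0∞) ≤ S.kl l φ (S.null l) := by
      -- A leaf holds at most one target, so on level 0 the true parameter itself serves as θ₁ and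
      -- AS1 replaces AS4.
      rcases Nat.eq_zero_or_pos l with rfl | hl
      · have : j = 1 := by simp at hj; omega
        subst this
        have hself : S.kl 0 φ φ = 0 := by rw [kl, klDiv_self]
        exact ⟨φ, hφ', by simp [hself], by simpa [hself] using (hdist 0 φ hφ').2⟩
      · exact hmult hl j hj0 (le_min hjK hj) φ hφ'
    obtain ⟨θ, hθ, hfin, hle⟩ := key
    simp only [hj0, iff_true, not_lt]
    refine (measure_gllr_nonpos_le E hΔ' hθ hk0 hfin (S.memLp_logRatio (hsq θ hθ))
      (S.integral_sq_logRatio_le (hsq θ hθ)) ?_ hn).trans (ENNReal.ofReal_le_ofReal ?_)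
    · rw [S.integral_logRatio hk0 hfin]
      have := ENNReal.toReal_mono hk0 hle
      rw [ENNReal.toReal_add hfin ENNReal.coe_ne_top, ENNReal.coe_toReal] at this
      linarith
    · have : 1 ≤ s := le_trans ((Set.ncard_pos hf).2 ⟨θ, hθ⟩) hs
      refine le_mul_of_one_le_left (by positivity) (by exact_mod_cast this)

/-- Sufficiently large samples make the internal tests reliable, uniformly in the level. -/
theorem exists_reliableTest {Δ : ℝ≥0} (hΔ : 0 < Δ) (hdist : S.Distinguishable Δ)
    (hfin : ∀ l, (S.anom l 1).Finite) (p : ℝ) (hp : p < 1) (V : ℝ≥0) (s : ℕ) :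
    ∃ n₀ : ℕ, ∀ K l : ℕ, 1 ≤ K →
      (1 ≤ l → S.MultiDistinguishable Δ K l) → S.MomentBound V K l → (S.anom l 1).ncard ≤ s →
      ∀ n, n₀ ≤ n → ReliableTest E K l n p := by
  have hΔ' : (0 : ℝ) < Δ := by exact_mod_cast hΔ
  -- Each of the two children gets half of the admissible error 1 - p.
  obtain ⟨n₀, hn₀⟩ := exists_nat_gt ((s * (V : ℝ) / (Δ : ℝ) ^ 2) / ((1 - p) / 2))
  have hn₀pos : 0 < n₀ := by
    have : (0 : ℝ) ≤ (s * (V : ℝ) / (Δ : ℝ) ^ 2) / ((1 - p) / 2) := by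
      have : 0 < 1 - p := by linarith
      positivity
    exact_mod_cast this.trans_lt hn₀
  refine ⟨n₀, fun K l _ hmult hmom hs n hn => ?_⟩
  have hnpos : 0 < n := hn₀pos.trans_le hn
  have hsmall : s * ((V : ℝ) / (n * (Δ : ℝ) ^ 2)) ≤ (1 - p) / 2 := by
    have h1 : s * (V : ℝ) / (Δ : ℝ) ^ 2 < n₀ * ((1 - p) / 2) :=
      (div_lt_iff₀ (by linarith)).1 hn₀
    have h2 : (n₀ : ℝ) * ((1 - p) / 2) ≤ n * ((1 - p) / 2) := by gcongr
    have h3 : s * ((V : ℝ) / (n * (Δ : ℝ) ^ 2)) = (s * (V : ℝ) / (Δ : ℝ) ^ 2) / n := by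
      field_simp
    rw [h3, div_le_iff₀ (by exact_mod_cast hnpos)]
    linarith
  have hbad : ∀ (a : Bool) (j : ℕ) (φ : Θ), (a = false → j = 0) → j ≤ 2 ^ l → j ≤ K →
      φ ∈ S.paramSet l j →
      Measure.pi (fun _ : Fin (if a then n else 0) => S.law l φ)
        {x | ¬ (0 < gllr E l (List.ofFn x) ↔ 0 < j)} ≤ ENNReal.ofReal ((1 - p) / 2) := by
    intro a j φ ha hj hjK hφ
    cases a with
    | true =>
      exact (measure_wrong_sign_le E hΔ hdist (hfin l) hs hmult hmom hj hjK hφ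
        (by simpa using hnpos)).trans (ENNReal.ofReal_le_ofReal (by simpa using hsmall))
    | false =>
      -- A removed child has no samples, statistic 0 and no targets, so its sign is right with
      -- certainty.
      have : {x : Fin (if false then n else 0) → Y |
          ¬ (0 < gllr E l (List.ofFn x) ↔ 0 < j)} = ∅ := by
        ext x
        simp [gllr_nil, ha rfl]
      simp only [Bool.false_eq_true, if_false] at this ⊢
      rw [this]; simp
  intro aL aR jL jR φL φR _ haL haR hjL hjR hK hφL hφR
  set P := (Measure.pi (fun _ : Fin (if aL then n else 0) => S.law l φL))
  set Q := (Measure.pi (fun _ : Fin (if aR then n else 0) => S.law l φR))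
  set A := {x : (Fin (if aL then n else 0) → Y) × (Fin (if aR then n else 0) → Y) |
    (internalMove (gllr E l (List.ofFn x.1)) (gllr E l (List.ofFn x.2))).Correct jL jR}
  have hAc : (P.prod Q) Aᶜ ≤ ENNReal.ofReal (1 - p) := by
    have hsub : Aᶜ ⊆ ({x | ¬ (0 < gllr E l (List.ofFn x) ↔ 0 < jL)} ×ˢ Set.univ) ∪
        (Set.univ ×ˢ {x | ¬ (0 < gllr E l (List.ofFn x) ↔ 0 < jR)}) := by
      intro x hx
      by_contra h
      simp only [Set.mem_union, Set.mem_prod, Set.mem_univ, and_true, true_and,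
        Set.mem_ofPred_eq, not_or, not_not] at h
      exact hx (internalMove_correct h.1 h.2)
    refine (measure_mono hsub).trans ((measure_union_le _ _).trans ?_)
    rw [Measure.prod_prod, Measure.prod_prod, measure_univ, measure_univ, mul_one, one_mul]
    refine (add_le_add (hbad aL jL φL haL hjL (by omega) hφL)
      (hbad aR jR φR haR hjR (by omega) hφR)).trans ?_
    rw [← ENNReal.ofReal_add (by linarith) (by linarith)]
    simp
  -- Subadditivity suffices here, so measurability of the event is not needed.
  have h1 : (1 : ℝ≥0∞) ≤ (P.prod Q) A + (P.prod Q) Aᶜ := by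
    rw [← measure_univ (μ := P.prod Q), ← Set.union_compl_self A]
    exact measure_union_le _ _
  have h2 : ENNReal.ofReal p + ENNReal.ofReal (1 - p) ≤ (P.prod Q) A + ENNReal.ofReal (1 - p) ∨
      p ≤ 0 := by
    rcases le_or_gt p 0 with h | h
    · exact Or.inr h
    · left
      rw [← ENNReal.ofReal_add h.le (by linarith)]
      simpa using h1.trans (by gcongr)
  rcases h2 with h2 | h2
  · exact (ENNReal.add_le_add_iff_right ENNReal.ofReal_ne_top).1 h2
  · simp [ENNReal.ofReal_of_nonpos h2]

end HierModel

/-! ### The drift criterion for the expected stopping time -/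

/-- A sequence of independent, identically distributed variables splits into its first term and
the sequence of the others. -/
lemma map_cons_prod_infinitePi {X : Type*} [MeasurableSpace X] (μ : Measure X)
    [IsProbabilityMeasure μ] :
    (μ.prod (Measure.infinitePi fun _ : ℕ => μ)).map
      (fun z t => Nat.casesOn (motive := fun _ => X) t z.1 z.2) =
      Measure.infinitePi fun _ : ℕ => μ := by
  classical
  have hmeas : Measurable (fun (z : X × (ℕ → X)) (t : ℕ) =>
      Nat.casesOn (motive := fun _ => X) t z.1 z.2) := by
    refine measurable_pi_iff.2 fun t => ?_
    cases t with
    | zero => exact measurable_fst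
    | succ t => exact (measurable_pi_apply t).comp measurable_snd
  refine Measure.eq_infinitePi _ fun s t ht => ?_
  obtain ⟨N, hN⟩ := s.exists_nat_subset_range
  -- Padding with the whole space turns the finite index set into an initial segment, from which
  -- coordinate 0 can be split off.
  set u : ℕ → Set X := fun i => if i ∈ s then t i else Set.univ with hu
  have hum : ∀ i, MeasurableSet (u i) := fun i => by
    simp only [hu]; split_ifs
    · exact ht i
    · exact MeasurableSet.univ
  have hpre : (fun (z : X × (ℕ → X)) (t : ℕ) => Nat.casesOn (motive := fun _ => X) t z.1 z.2) ⁻¹'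
      (Set.pi s t) = u 0 ×ˢ Set.pi (Finset.range N) (fun i => u (i + 1)) := by
    ext z
    simp only [Set.mem_preimage, Set.mem_pi, Set.mem_prod, hu, Finset.mem_coe]
    constructor
    · intro h
      refine ⟨?_, fun i _ => ?_⟩
      · split_ifs with h0
        · exact h 0 h0
        · trivial
      · split_ifs with h0
        · exact h (i + 1) h0
        · trivial
    · rintro ⟨h0, h1⟩ i hi
      cases i with
      | zero => simpa [hi] using h0
      | succ i =>
        have := Finset.mem_range.1 (hN hi)
        simpa [hi] using h1 i (Finset.mem_range.2 (by omega))
  rw [Measure.map_apply hmeas (MeasurableSet.pi s.countable_toSet fun i _ => ht i), hpre,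
    Measure.prod_prod, Measure.infinitePi_pi _ fun i _ => hum (i + 1)]
  have h1 : ∏ i ∈ s, μ (t i) = ∏ i ∈ Finset.range (N + 1), μ (u i) := by
    rw [← Finset.prod_subset (hN.trans (Finset.range_mono (Nat.le_succ N)))]
    · exact Finset.prod_congr rfl fun i hi => by simp [hu, hi]
    · intro i _ hi
      simp [hu, hi]
  rw [h1, Finset.prod_range_succ', mul_comm]

namespace HDSParams

variable {Θ Y : Type*} [MeasurableSpace Y] {S : HierModel Θ Y} (A : HDSParams) (E : S.MLE)

/-- The state after `t` samples of a search that starts in the state `s`. -/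
noncomputable def stateFrom (s : HDSState Y) (ω : ℕ → Finset ℕ × ℕ × ℕ → Y) : ℕ → HDSState Y
  | 0 => s
  | t + 1 => A.update E (stateFrom s ω t)
      (ω t ((stateFrom s ω t).removed, A.query (stateFrom s ω t)))

lemma state_eq_stateFrom (ω : ℕ → Finset ℕ × ℕ × ℕ → Y) (t : ℕ) :
    A.state E ω t = A.stateFrom E (A.start ∅) ω t := by
  induction t with
  | zero => rfl
  | succ t ih => rw [state, stateFrom, ih]

lemma stateFrom_succ' (s : HDSState Y) (ω : ℕ → Finset ℕ × ℕ × ℕ → Y) (t : ℕ) :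
    A.stateFrom E s ω (t + 1) =
      A.stateFrom E (A.update E s (ω 0 (s.removed, A.query s))) (fun k => ω (k + 1)) t := by
  induction t with
  | zero => rfl
  | succ t ih => rw [stateFrom, ih, stateFrom]

/-- The number of samples until `K` leaves have been declared, truncated at `n`, of a search that
starts in the state `s`. -/
noncomputable def truncTime : ℕ → HDSState Y → (ℕ → Finset ℕ × ℕ × ℕ → Y) → ℝ≥0∞
  | 0, _, _ => 0
  | n + 1, s, ω => if A.K ≤ s.removed.card then 0 else
      1 + truncTime n (A.update E s (ω 0 (s.removed, A.query s))) (fun k => ω (k + 1))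

lemma min_stopTime_le_truncTime (n : ℕ) (s : HDSState Y) (ω : ℕ → Finset ℕ × ℕ × ℕ → Y) :
    min (⨅ (t : ℕ) (_ : A.K ≤ (A.stateFrom E s ω t).removed.card), (t : ℝ≥0∞)) n
      ≤ A.truncTime E n s ω := by
  induction n generalizing s ω with
  | zero => simp
  | succ n ih =>
    rw [truncTime]
    split_ifs with h
    · exact (min_le_left _ _).trans (iInf₂_le_of_le 0 h (by simp))
    · refine le_trans ?_ (add_le_add_right (ih _ _) 1)
      rw [add_min]
      refine min_le_min ?_ (by push_cast; rw [add_comm])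
      rw [ENNReal.add_iInf]
      refine le_iInf fun t => ?_
      by_cases ht : A.K ≤ (A.stateFrom E (A.update E s (ω 0 (s.removed, A.query s)))
          (fun k => ω (k + 1)) t).removed.card
      · refine iInf₂_le_of_le (t + 1) (by rwa [stateFrom_succ']) ?_
        simp [ht, add_comm]
      · simp [ht]

/-- Monotone convergence is applied to a measurable minorant of the stopping time with the same
integral, so the stopping time itself need not be shown measurable. -/
lemma lintegral_stopTime_le {P : Measure (ℕ → Finset ℕ × ℕ × ℕ → Y)} {x : ℝ≥0∞}
    (h : ∀ n, ∫⁻ ω, A.truncTime E n (A.start ∅) ω ∂P ≤ x) :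
    ∫⁻ ω, A.stopTime E ω ∂P ≤ x := by
  obtain ⟨g, hgm, hgle, hg⟩ := exists_measurable_le_lintegral_eq P (fun ω => A.stopTime E ω)
  rw [hg]
  have hsup : ∀ ω, g ω = ⨆ n : ℕ, min (g ω) n := fun ω => by
    rw [← inf_iSup_eq, ENNReal.iSup_natCast, inf_top_eq]
  calc ∫⁻ ω, g ω ∂P = ∫⁻ ω, ⨆ n : ℕ, min (g ω) n ∂P := lintegral_congr hsup
    _ = ⨆ n : ℕ, ∫⁻ ω, min (g ω) n ∂P := by
      refine lintegral_iSup (fun n => hgm.min measurable_const) fun m n hmn ω => ?_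
      exact min_le_min_left _ (by exact_mod_cast hmn)
    _ ≤ x := iSup_le fun n => (lintegral_mono fun ω => ?_).trans (h n)
  refine le_trans (min_le_min_right _ (hgle ω)) ?_
  have := A.min_stopTime_le_truncTime E n (A.start ∅) ω
  simpa only [stopTime, state_eq_stateFrom] using this

/-- A potential that decreases by one per sample on average bounds the number of samples. -/
theorem lintegral_truncTime_le {param : Finset ℕ → ℕ → ℕ → Θ}
    (Good : HDSState Y → ℝ≥0∞ → Prop)
    (hstep : ∀ s x, Good s x → A.K ≤ s.removed.card ∨
      ∃ g : Y → ℝ≥0∞, Measurable g ∧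
        1 + ∫⁻ y, g y ∂(S.law (A.query s).1 (param s.removed (A.query s).1 (A.query s).2)) ≤ x ∧
        ∀ᵐ y ∂(S.law (A.query s).1 (param s.removed (A.query s).1 (A.query s).2)),
          ∃ x' ≤ g y, Good (A.update E s y) x')
    (n : ℕ) (s : HDSState Y) (x : ℝ≥0∞) (hs : Good s x) :
    ∫⁻ ω, A.truncTime E n s ω ∂(obsLaw S param) ≤ x := by
  induction n generalizing s x with
  | zero => simp [truncTime]
  | succ n ih =>
    rcases hstep s x hs with h | ⟨g, hgm, hgx, hg⟩
    · simp [truncTime, h]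
    by_cases h : A.K ≤ s.removed.card
    · simp [truncTime, h]
    set M := Measure.infinitePi (fun a : Finset ℕ × ℕ × ℕ => S.law a.2.1 (param a.1 a.2.1 a.2.2))
    have hobs : obsLaw S param = Measure.infinitePi fun _ : ℕ => M := rfl
    set a : Finset ℕ × ℕ × ℕ := (s.removed, A.query s)
    have hpres := measurePreserving_eval_infinitePi
      (fun a : Finset ℕ × ℕ × ℕ => S.law a.2.1 (param a.1 a.2.1 a.2.2)) a
    -- The observations at time 0 are split off. The truncated time is not known to be measurable,
    -- but for the lower integral the change of variables and Tonelli's theorem hold as inequalities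
    -- in the direction needed.
    calc ∫⁻ ω, A.truncTime E (n + 1) s ω ∂(obsLaw S param)
        ≤ ∫⁻ z, A.truncTime E (n + 1) s
            (fun t => Nat.casesOn (motive := fun _ => Finset ℕ × ℕ × ℕ → Y) t z.1 z.2)
            ∂(M.prod (obsLaw S param)) := by
          conv_lhs => rw [hobs, ← map_cons_prod_infinitePi M]
          exact lintegral_map_le _ _
      _ = ∫⁻ z, (1 + A.truncTime E n (A.update E s (z.1 a)) z.2) ∂(M.prod (obsLaw S param)) := by
          simp only [truncTime, h, if_false]
          rfl
      _ ≤ ∫⁻ x, ∫⁻ ω, (1 + A.truncTime E n (A.update E s (x a)) ω) ∂(obsLaw S param) ∂M :=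
          lintegral_prod_le _
      _ ≤ ∫⁻ x, (1 + g (x a)) ∂M := by
          refine lintegral_mono_ae ?_
          filter_upwards [hpres.quasiMeasurePreserving.ae hg] with x hx
          obtain ⟨x', hx', hG⟩ := hx
          rw [lintegral_add_left measurable_const]
          have : IsProbabilityMeasure (obsLaw S param) := by rw [hobs]; infer_instance
          simpa using add_le_add_right ((ih _ _ hG).trans hx') 1
      _ = 1 + ∫⁻ y, g y ∂(S.law (A.query s).1 (param s.removed (A.query s).1 (A.query s).2)) := by
          rw [lintegral_add_left measurable_const, lintegral_const, measure_univ, mul_one,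
            ← hpres.lintegral_comp hgm]
      _ ≤ x := hgx

end HDSParams

/-! ### Potentials of leaf tests, and the test of a normal leaf -/

lemma one_add_lintegral_ofReal_le {Y : Type*} [MeasurableSpace Y] {μ : Measure Y} {q : Y → ℝ}
    (hq : Integrable q μ) (h0 : ∀ y, 0 ≤ q y) {Q : ℝ} (hQ : ∫ y, q y ∂μ + 1 ≤ Q) :
    1 + ∫⁻ y, ENNReal.ofReal (q y) ∂μ ≤ ENNReal.ofReal Q := by
  rw [← ofReal_integral_eq_lintegral_ofReal hq (Filter.Eventually.of_forall h0),
    ← ENNReal.ofReal_one, ← ENNReal.ofReal_add zero_le_one (integral_nonneg h0)]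
  exact ENNReal.ofReal_le_ofReal (by linarith)

namespace HierModel

variable {Θ Y : Type*} [MeasurableSpace Y] {S : HierModel Θ Y} (E : S.MLE)

lemma allr_append (N₀ : ℕ) (d : List Y) (y : Y) :
    allr E N₀ (d ++ [y]) =
      allr E N₀ d + if N₀ ≤ d.length then S.logRatio 0 (E.est 0 d) y else 0 := by
  unfold allr
  have h : d.length + 1 = (d ++ [y]).length := by simp
  rw [← Fin.sum_congr' _ h, Fin.sum_univ_castSucc]
  congr 1
  · refine Finset.sum_congr rfl fun i _ => ?_
    have h1 : (d ++ [y]).take (i : ℕ) = d.take i := by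
      rw [List.take_append_of_le_length i.2.le]
    simp [h1]
  · simp

lemma allr_eq_zero (N₀ : ℕ) {d : List Y} (h : d.length ≤ N₀) : allr E N₀ d = 0 :=
  Finset.sum_eq_zero fun i _ => if_neg (by have := i.2; omega)

open Classical in
/-- The expected cost-to-go after the samples `d` of a leaf test, if it is `Ψ d` as long as the test
continues, `v` after a rejection and `0` after the declaration of the leaf. -/
noncomputable def leafCost (N₀ : ℕ) (b : ℝ) (Ψ : List Y → ℝ≥0∞) (v : ℝ≥0∞) (d : List Y) : ℝ≥0∞ :=
  if d.length ≤ N₀ then Ψ d else if b < allr E N₀ d then 0 else if allr E N₀ d < 0 then v else Ψ d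

/-- A leaf test with acceptance threshold `b` of a leaf with distribution `μ` has expected cost at
most `u`, if a rejection has the additional cost `v`; this is witnessed by the potential `Ψ`. -/
def LeafPotential (N₀ : ℕ) (b : ℝ) (μ : Measure Y) (v : ℝ≥0∞) (Ψ : List Y → ℝ≥0∞) : Prop :=
  ∀ d : List Y, (d.length ≤ N₀ ∨ (0 ≤ allr E N₀ d ∧ allr E N₀ d ≤ b)) →
    ∃ g : Y → ℝ≥0∞, Measurable g ∧ 1 + ∫⁻ y, g y ∂μ ≤ Ψ d ∧
      ∀ᵐ y ∂μ, leafCost E N₀ b Ψ v (d ++ [y]) ≤ g y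

/-- The test of a normal leaf ends after a bounded expected number of samples. -/
theorem exists_leafPotential_null {Δ V : ℝ} (hΔ : 0 < Δ) (hV0 : 0 ≤ V)
    (hL2 : ∀ θ ∈ S.anom 0 1, MemLp (S.logRatio 0 θ) 2 (S.law 0 (S.null 0)))
    (hV : ∀ θ ∈ S.anom 0 1, ∫ y, S.logRatio 0 θ y ^ 2 ∂(S.law 0 (S.null 0)) ≤ V)
    (hm : ∀ θ ∈ S.anom 0 1, ∫ y, S.logRatio 0 θ y ∂(S.law 0 (S.null 0)) ≤ -Δ)
    (N₀ : ℕ) (b v : ℝ) (hv : 0 ≤ v) :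
    ∃ Ψ : List Y → ℝ≥0∞, Ψ [] ≤ ENNReal.ofReal (v + (N₀ + V / Δ ^ 2 + 1)) ∧
      LeafPotential E N₀ b (S.law 0 (S.null 0)) (ENNReal.ofReal v) Ψ := by
  set μ := S.law 0 (S.null 0)
  -- β absorbs the undershoot below 0 at the rejection; its size makes the quadratic correction
  -- below cost at most 1 per sample.
  set β : ℝ := V / Δ ^ 2 + 1 with hβ
  have hβ0 : 0 < β := by positivity
  -- With slope 2/Δ the sum loses at least 2 per sample on average: one pays for the sample, the
  -- other for the quadratic correction.
  refine ⟨fun d => ENNReal.ofReal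
    (v + β + ((N₀ - d.length : ℕ) : ℝ) + 2 / Δ * allr E N₀ d), ?_, ?_⟩
  · refine ENNReal.ofReal_le_ofReal (le_of_eq ?_)
    rw [allr_eq_zero E N₀ (by simp)]
    simp [hβ]; ring
  intro d hd
  rcases lt_or_ge d.length N₀ with hlt | hge
  · refine ⟨fun _ => ENNReal.ofReal (v + β + ((N₀ - (d.length + 1) : ℕ) : ℝ)), measurable_const,
      one_add_lintegral_ofReal_le (integrable_const _) (fun _ => by positivity) ?_,
      Filter.Eventually.of_forall fun y => ?_⟩
    · rw [allr_eq_zero E N₀ hlt.le]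
      have : N₀ - d.length = (N₀ - (d.length + 1)) + 1 := by omega
      rw [this]; simp; linarith
    · have hl : (d ++ [y]).length ≤ N₀ := by simp; omega
      rw [leafCost, if_pos hl, allr_eq_zero E N₀ hl]
      simp
  · set s := allr E N₀ d with hs
    have hs0 : 0 ≤ s := by
      rcases hd with h | h
      · rw [hs, allr_eq_zero E N₀ h]
      · exact h.1
    have hmem := E.mem 0 d
    set Z := S.logRatio 0 (E.est 0 d)
    have hZi : Integrable Z μ := (hL2 _ hmem).integrable (by norm_num)
    have hZ2 : Integrable (fun y => Z y ^ 2) μ := (hL2 _ hmem).integrable_sq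
    -- Completing the square: the correction z² / (Δ²β) is the least that keeps the value
    -- nonnegative for every step z, so a rejection still leaves v.
    have hnn : ∀ z : ℝ, 0 ≤ β + 2 / Δ * z + (2 / Δ) ^ 2 * z ^ 2 / (4 * β) := fun z => by
      have : β + 2 / Δ * z + (2 / Δ) ^ 2 * z ^ 2 / (4 * β) =
          (2 / Δ * z + 2 * β) ^ 2 / (4 * β) := by field_simp; ring
      rw [this]; positivity
    have hs' : 0 ≤ 2 / Δ * s := by positivity
    refine ⟨fun y => ENNReal.ofReal
      (v + 2 / Δ * s + (β + 2 / Δ * Z y + (2 / Δ) ^ 2 * Z y ^ 2 / (4 * β))), ?_,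
      one_add_lintegral_ofReal_le ?_ (fun y => ?_) ?_, Filter.Eventually.of_forall fun y => ?_⟩
    · have := S.measurable_logRatio 0 (E.est 0 d)
      fun_prop
    · exact (integrable_const _).add (((integrable_const _).add (hZi.const_mul _)).add
        ((hZ2.const_mul _).div_const _))
    · have := hnn (Z y); positivity
    · have i1 : Integrable (fun y => 2 / Δ * Z y) μ := hZi.const_mul _
      have i2 : Integrable (fun y => β + 2 / Δ * Z y) μ := (integrable_const _).add i1
      have i3 : Integrable (fun y => (2 / Δ) ^ 2 * Z y ^ 2 / (4 * β)) μ :=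
        (hZ2.const_mul _).div_const _
      have i4 : Integrable (fun y => β + 2 / Δ * Z y + (2 / Δ) ^ 2 * Z y ^ 2 / (4 * β)) μ :=
        i2.add i3
      rw [integral_add (integrable_const _) i4, integral_add i2 i3,
        integral_add (integrable_const _) i1, integral_div, integral_const_mul,
        integral_const_mul]
      simp only [integral_const, probReal_univ, smul_eq_mul, one_mul]
      have h1 : 2 / Δ * ∫ y, Z y ∂μ ≤ -2 := by
        have : 2 / Δ * ∫ y, Z y ∂μ ≤ 2 / Δ * (-Δ) :=
          mul_le_mul_of_nonneg_left (hm _ hmem) (by positivity)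
        have e : 2 / Δ * (-Δ) = -2 := by field_simp
        linarith
      have h2 : (2 / Δ) ^ 2 * (∫ y, Z y ^ 2 ∂μ) / (4 * β) ≤ 1 := by
        rw [div_le_one (by positivity)]
        calc (2 / Δ) ^ 2 * (∫ y, Z y ^ 2 ∂μ) ≤ (2 / Δ) ^ 2 * V := by
              gcongr; exact hV _ hmem
          _ = 4 * (V / Δ ^ 2) := by ring
          _ ≤ 4 * β := by rw [hβ]; linarith
      have h3 : (0 : ℝ) ≤ ((N₀ - d.length : ℕ) : ℝ) := by positivity
      linarith
    · have hl : ¬ (d ++ [y]).length ≤ N₀ := by simp; omega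
      have ha : allr E N₀ (d ++ [y]) = s + Z y := by rw [allr_append, if_pos hge]
      have h0 := hnn (Z y)
      have h4 : 0 ≤ (2 / Δ) ^ 2 * Z y ^ 2 / (4 * β) := by positivity
      rw [leafCost, if_neg hl, ha]
      split_ifs
      · simp
      · exact ENNReal.ofReal_le_ofReal (by linarith)
      · refine ENNReal.ofReal_le_ofReal ?_
        have : N₀ - (d ++ [y]).length = 0 := by simp; omega
        rw [this]; push_cast
        nlinarith

end HierModel

/-! ### Passage times of a random walk, with control of the overshoot -/

section Overshoot

variable {Y : Type*} [MeasurableSpace Y] {μ : Measure Y}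

/-- The mean excess of `Z` over `y`. -/
noncomputable def meanExcess (μ : Measure Y) (Z : Y → ℝ) (y : ℝ) : ℝ := ∫ ω, max (Z ω - y) 0 ∂μ

/-- The mean squared excess of `Z` over `y`. -/
noncomputable def meanSqExcess (μ : Measure Y) (Z : Y → ℝ) (y : ℝ) : ℝ :=
  ∫ ω, max (Z ω - y) 0 ^ 2 ∂μ

lemma meanExcess_nonneg (Z : Y → ℝ) (y : ℝ) : 0 ≤ meanExcess μ Z y :=
  integral_nonneg fun _ => le_max_right _ _

lemma meanSqExcess_nonneg (Z : Y → ℝ) (y : ℝ) : 0 ≤ meanSqExcess μ Z y :=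
  integral_nonneg fun _ => by positivity

/-- An upper bound for the expected time until a random walk with step `Z` of mean at least `D`
exceeds a level that is `y - β` above its position, with a correction for the overshoot. -/
noncomputable def passagePotential (μ : Measure Y) (Z : Y → ℝ) (D c V y : ℝ) : ℝ :=
  y / D - c / 2 * meanSqExcess μ Z y + c / 2 * V

/-- The tangent of `passagePotential` at `y` after a step `z`, corrected for the overshoot. -/
noncomputable def passageTangent (μ : Measure Y) (Z : Y → ℝ) (D c V y z : ℝ) : ℝ :=
  passagePotential μ Z D c V y + (1 / D + c * meanExcess μ Z y) * (max (z - y) 0 - z)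

lemma passagePotential_le {Z : Y → ℝ} {D c V : ℝ} (hc : 0 ≤ c) (y : ℝ) :
    passagePotential μ Z D c V y ≤ y / D + c / 2 * V := by
  have := mul_nonneg (by linarith : 0 ≤ c / 2) (meanSqExcess_nonneg (μ := μ) Z y)
  unfold passagePotential; linarith

variable [IsProbabilityMeasure μ]

lemma memLp_excess {Z : Y → ℝ} (hZ : MemLp Z 2 μ) (y : ℝ) :
    MemLp (fun ω => max (Z ω - y) 0) 2 μ :=
  (hZ.sub (memLp_const y)).pos_part

lemma meanExcess_le {Z : Y → ℝ} (hZ : MemLp Z 2 μ) {V y : ℝ} (hV : ∫ ω, Z ω ^ 2 ∂μ ≤ V)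
    (hy : 0 < y) : meanExcess μ Z y ≤ V / (4 * y) := by
  calc meanExcess μ Z y ≤ ∫ ω, Z ω ^ 2 / (4 * y) ∂μ := by
        refine integral_mono ((memLp_excess hZ y).integrable (by norm_num))
          (hZ.integrable_sq.div_const _) fun ω => max_le ?_ (by positivity)
        rw [le_div_iff₀ (by positivity)]
        nlinarith [sq_nonneg (Z ω - 2 * y)]
    _ ≤ V / (4 * y) := by rw [integral_div]; gcongr

lemma meanSqExcess_le {Z : Y → ℝ} (hZ : MemLp Z 2 μ) {V y : ℝ} (hV : ∫ ω, Z ω ^ 2 ∂μ ≤ V)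
    (hy : 0 ≤ y) : meanSqExcess μ Z y ≤ V := by
  refine le_trans (integral_mono (memLp_excess hZ y).integrable_sq hZ.integrable_sq fun ω => ?_) hV
  rcases le_total (Z ω - y) 0 with h | h
  · have := sq_nonneg (Z ω)
    simpa [max_eq_right h] using this
  · simp only [max_eq_left h]
    nlinarith

/-- The squared positive part is convex and lies above its tangent. This makes the passage potential
concave in the remaining height. -/
lemma meanSqExcess_add_le {Z : Y → ℝ} (hZ : MemLp Z 2 μ) (y z : ℝ) :
    meanSqExcess μ Z y + 2 * z * meanExcess μ Z y ≤ meanSqExcess μ Z (y - z) := by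
  unfold meanSqExcess meanExcess
  have h1 := (memLp_excess hZ y).integrable_sq
  have h2 := ((memLp_excess hZ y).integrable (by norm_num : (1 : ℝ≥0∞) ≤ 2)).const_mul (2 * z)
  rw [← integral_const_mul, ← integral_add h1 h2]
  refine integral_mono (h1.add h2) (memLp_excess hZ (y - z)).integrable_sq fun ω => ?_
  simp only
  rcases le_total (Z ω - y) 0 with h | h
  · rw [max_eq_right h]; simp only [mul_zero, add_zero, ne_eq, OfNat.ofNat_ne_zero,
      not_false_eq_true, zero_pow]; positivity
  · rw [max_eq_left h]
    have h3 : Z ω - (y - z) ≤ max (Z ω - (y - z)) 0 := le_max_left _ _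
    have h4 : 0 ≤ max (Z ω - (y - z)) 0 := le_max_right _ _
    rcases le_total (Z ω - (y - z)) 0 with h5 | h5
    · rw [max_eq_right h5]; nlinarith
    · rw [max_eq_left h5]; nlinarith [sq_nonneg z]

lemma le_passagePotential {Z : Y → ℝ} (hZ : MemLp Z 2 μ) {D c V : ℝ} (hc : 0 ≤ c)
    (hV : ∫ ω, Z ω ^ 2 ∂μ ≤ V) {y : ℝ} (hy : 0 ≤ y) :
    y / D ≤ passagePotential μ Z D c V y := by
  have := mul_le_mul_of_nonneg_left (meanSqExcess_le hZ hV hy) (by linarith : 0 ≤ c / 2)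
  unfold passagePotential; linarith

/-- The potential is concave with slope 1/D + c · `meanExcess`, so it lies below its tangent; the
overshoot term only raises the right-hand side. -/
lemma passagePotential_le_tangent {Z : Y → ℝ} (hZ : MemLp Z 2 μ) {D c V : ℝ} (hD : 0 < D)
    (hc : 0 ≤ c) (y z : ℝ) :
    passagePotential μ Z D c V (y - z) ≤ passageTangent μ Z D c V y z := by
  have h1 := mul_le_mul_of_nonneg_left (meanSqExcess_add_le hZ y z) (by linarith : 0 ≤ c / 2)
  have h2 : 0 ≤ (1 / D + c * meanExcess μ Z y) * max (z - y) 0 :=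
    mul_nonneg (add_nonneg (by positivity) (mul_nonneg hc (meanExcess_nonneg Z y)))
      (le_max_right _ _)
  have h3 : (y - z) / D = y / D - 1 / D * z := by ring
  unfold passageTangent passagePotential
  rw [h3]
  nlinarith

/-- The corrected tangent is constant for z ≥ y, so a large last step cannot make it negative; at z
= y it is still at least the potential at height 0. -/
lemma passageTangent_nonneg {Z : Y → ℝ} (hZ : MemLp Z 2 μ) {D c V : ℝ} (hD : 0 < D)
    (hc : 0 ≤ c) (hV : ∫ ω, Z ω ^ 2 ∂μ ≤ V) (y z : ℝ) :
    0 ≤ passageTangent μ Z D c V y z := by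
  rcases le_total z y with h | h
  · refine le_trans ?_ (passagePotential_le_tangent hZ hD hc y z)
    exact le_trans (div_nonneg (by linarith) hD.le) (le_passagePotential hZ hc hV (by linarith))
  · have h1 := passagePotential_le_tangent (V := V) hZ hD hc y y
    have h2 : passageTangent μ Z D c V y z = passageTangent μ Z D c V y y := by
      unfold passageTangent
      rw [max_eq_left (by linarith), max_eq_right (by linarith)]
      ring
    rw [h2]
    refine le_trans ?_ h1
    exact le_trans (div_nonneg (by linarith) hD.le) (le_passagePotential hZ hc hV (by linarith))

lemma integrable_passageTangent {Z Z' : Y → ℝ} (hZ' : MemLp Z' 2 μ) (D c V y : ℝ) :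
    Integrable (fun ω => passageTangent μ Z D c V y (Z' ω)) μ :=
  (integrable_const _).add ((((memLp_excess hZ' y).integrable (by norm_num)).sub
    (hZ'.integrable (by norm_num))).const_mul _)

lemma integral_passageTangent {Z Z' : Y → ℝ} (hZ' : MemLp Z' 2 μ) (D c V y : ℝ) :
    ∫ ω, passageTangent μ Z D c V y (Z' ω) ∂μ = passagePotential μ Z D c V y +
      (1 / D + c * meanExcess μ Z y) * (meanExcess μ Z' y - ∫ ω, Z' ω ∂μ) := by
  have i1 := (memLp_excess hZ' y).integrable (by norm_num : (1 : ℝ≥0∞) ≤ 2)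
  have i2 := hZ'.integrable (by norm_num : (1 : ℝ≥0∞) ≤ 2)
  have i3 : Integrable (fun ω => (1 / D + c * meanExcess μ Z y) * (max (Z' ω - y) 0 - Z' ω)) μ :=
    (i1.sub i2).const_mul _
  unfold passageTangent
  rw [integral_add (integrable_const _) i3, integral_const_mul, integral_sub i1 i2]
  simp [meanExcess]

/-- The passage potential decreases by one on average in a step of the walk. -/
lemma integral_passageTangent_le {Z : Y → ℝ} (hZ : MemLp Z 2 μ) {Δ D V y : ℝ} (hΔ : 0 < Δ)
    (hD : Δ ≤ D) (hmean : D ≤ ∫ ω, Z ω ∂μ) (hr : meanExcess μ Z y ≤ Δ / 2) :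
    ∫ ω, passageTangent μ Z D (2 / Δ ^ 2) V y (Z ω) ∂μ + 1
      ≤ passagePotential μ Z D (2 / Δ ^ 2) V y := by
  rw [integral_passageTangent hZ]
  set r := meanExcess μ Z y
  have hr0 : 0 ≤ r := meanExcess_nonneg Z y
  have hD0 : 0 < D := hΔ.trans_le hD
  have hk : 0 ≤ 1 / D + 2 / Δ ^ 2 * r := by positivity
  have h1 : (1 / D + 2 / Δ ^ 2 * r) * (r - ∫ ω, Z ω ∂μ) ≤ (1 / D + 2 / Δ ^ 2 * r) * (r - D) :=
    mul_le_mul_of_nonneg_left (by linarith) hk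
  have h2 : 1 / D ≤ 1 / Δ := one_div_le_one_div_of_le hΔ hD
  -- The overshoot loses r/D of the drift; the additional slope c·r with c = 2/Δ² regains at least
  -- r/Δ, as r ≤ Δ/2 ≤ D - r.
  have h3 : 2 / Δ ^ 2 * r * (D - r) ≥ 2 / Δ ^ 2 * r * (Δ / 2) :=
    mul_le_mul_of_nonneg_left (by linarith) (by positivity)
  have h4 : 2 / Δ ^ 2 * r * (Δ / 2) = 1 / Δ * r := by field_simp
  have h5 : 1 / D * r ≤ 1 / Δ * r := mul_le_mul_of_nonneg_right h2 hr0
  have h6 : 1 / D * D = 1 := by field_simp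
  nlinarith

/-- The passage potential increases by a bounded amount if the step has another distribution. -/
lemma integral_passageTangent_le_add {Z Z' : Y → ℝ} (hZ' : MemLp Z' 2 μ)
    {Δ D V y : ℝ} (hΔ : 0 < Δ) (hD : Δ ≤ D) (hV : ∫ ω, Z' ω ^ 2 ∂μ ≤ V)
    (hy : 0 ≤ y) (hr : meanExcess μ Z y ≤ Δ / 2) :
    ∫ ω, passageTangent μ Z D (2 / Δ ^ 2) V y (Z' ω) ∂μ
      ≤ passagePotential μ Z D (2 / Δ ^ 2) V y + 2 / Δ * (1 + V) := by
  rw [integral_passageTangent hZ']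
  set r := meanExcess μ Z y
  have hr0 : 0 ≤ r := meanExcess_nonneg Z y
  have hD0 : 0 < D := hΔ.trans_le hD
  have i1 := (memLp_excess hZ' y).integrable (by norm_num : (1 : ℝ≥0∞) ≤ 2)
  have i2 := hZ'.integrable (by norm_num : (1 : ℝ≥0∞) ≤ 2)
  have h1 : meanExcess μ Z' y - ∫ ω, Z' ω ∂μ ≤ 1 + V := by
    rw [meanExcess, ← integral_sub i1 i2]
    calc _ ≤ ∫ ω, (1 + Z' ω ^ 2) ∂μ := by
          refine integral_mono (i1.sub i2) ((integrable_const _).add hZ'.integrable_sq) fun ω => ?_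
          simp only
          rcases le_total (Z' ω - y) 0 with h | h
          · rw [max_eq_right h]; nlinarith [sq_nonneg (Z' ω + 1)]
          · rw [max_eq_left h]; nlinarith [sq_nonneg (Z' ω)]
      _ ≤ 1 + V := by
          rw [integral_add (integrable_const _) hZ'.integrable_sq]; simpa using hV
  have hV0 : 0 ≤ V := le_trans (integral_nonneg fun _ => sq_nonneg _) hV
  have h2 : 1 / D + 2 / Δ ^ 2 * r ≤ 2 / Δ := by
    have h3 : 1 / D ≤ 1 / Δ := one_div_le_one_div_of_le hΔ hD
    have h4 : 2 / Δ ^ 2 * r ≤ 2 / Δ ^ 2 * (Δ / 2) := by gcongr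
    have h5 : 2 / Δ ^ 2 * (Δ / 2) = 1 / Δ := by field_simp
    have h6 : 2 / Δ = 1 / Δ + 1 / Δ := by ring
    linarith
  have hk : 0 ≤ 1 / D + 2 / Δ ^ 2 * r := by positivity
  have h3 := mul_le_mul_of_nonneg_left h1 hk
  have h4 : (1 / D + 2 / Δ ^ 2 * r) * (1 + V) ≤ 2 / Δ * (1 + V) := by gcongr
  linarith

end Overshoot

/-! ### Affinities, wrong estimates and the risk of rejecting a target -/

namespace HierModel

variable {Θ Y : Type*} [MeasurableSpace Y] (S : HierModel Θ Y)

/-- The likelihood ratio of two parameters of a leaf. -/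
noncomputable def leafRatio (θ θ' : Θ) (y : Y) : ℝ :=
  (S.density 0 θ' y : ℝ) / (S.density 0 θ y : ℝ)

lemma leafRatio_nonneg (θ θ' : Θ) (y : Y) : 0 ≤ S.leafRatio θ θ' y := by
  unfold leafRatio; positivity

lemma measurable_leafRatio (θ θ' : Θ) : Measurable (S.leafRatio θ θ') :=
  (S.measurable_coe_density 0 θ').div (S.measurable_coe_density 0 θ)

/-- Only an inequality in general: θ' may put mass where the density of θ vanishes. -/
lemma lintegral_leafRatio_le (θ θ' : Θ) :
    ∫⁻ y, ENNReal.ofReal (S.leafRatio θ θ' y) ∂(S.law 0 θ) ≤ 1 := by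
  rw [S.lintegral_law, ← S.lintegral_density 0 θ']
  refine lintegral_mono fun y => ?_
  rw [leafRatio, ← NNReal.coe_div, ENNReal.ofReal_coe_nnreal, ← ENNReal.coe_mul]
  refine ENNReal.coe_le_coe.2 ?_
  by_cases h : S.density 0 θ y = 0
  · simp [h]
  · rw [mul_div_cancel₀ _ h]

lemma integrable_leafRatio (θ θ' : Θ) : Integrable (S.leafRatio θ θ') (S.law 0 θ) := by
  refine ⟨(S.measurable_leafRatio θ θ').aestronglyMeasurable, ?_⟩
  rw [hasFiniteIntegral_iff_ofReal (Filter.Eventually.of_forall (S.leafRatio_nonneg θ θ'))]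
  exact (S.lintegral_leafRatio_le θ θ').trans_lt ENNReal.one_lt_top

lemma integral_leafRatio_le (θ θ' : Θ) : ∫ y, S.leafRatio θ θ' y ∂(S.law 0 θ) ≤ 1 := by
  rw [integral_eq_lintegral_of_nonneg_ae (Filter.Eventually.of_forall (S.leafRatio_nonneg θ θ'))
    (S.measurable_leafRatio θ θ').aestronglyMeasurable]
  exact ENNReal.toReal_le_of_le_ofReal zero_le_one (by simpa using S.lintegral_leafRatio_le θ θ')

/-- The Hellinger affinity of two parameters of a leaf. -/
noncomputable def affinity (θ θ' : Θ) : ℝ := ∫ y, √(S.leafRatio θ θ' y) ∂(S.law 0 θ)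

lemma affinity_nonneg (θ θ' : Θ) : 0 ≤ S.affinity θ θ' :=
  integral_nonneg fun _ => Real.sqrt_nonneg _

lemma integrable_sqrt_leafRatio (θ θ' : Θ) :
    Integrable (fun y => √(S.leafRatio θ θ' y)) (S.law 0 θ) := by
  refine Integrable.mono' ((integrable_const (1 : ℝ)).add (S.integrable_leafRatio θ θ'))
    (S.measurable_leafRatio θ θ').sqrt.aestronglyMeasurable
    (Filter.Eventually.of_forall fun y => ?_)
  have h := S.leafRatio_nonneg θ θ' y
  rw [Real.norm_of_nonneg (Real.sqrt_nonneg _), Pi.add_apply]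
  nlinarith [Real.sq_sqrt h, sq_nonneg (√(S.leafRatio θ θ' y) - 1),
    Real.sqrt_nonneg (S.leafRatio θ θ' y)]

/-- Parameters with affinity one have the same log-likelihood ratio. -/
lemma logRatio_ae_eq_of_affinity {θ θ' : Θ} (h : 1 ≤ S.affinity θ θ') :
    S.logRatio 0 θ' =ᵐ[S.law 0 θ] S.logRatio 0 θ := by
  have i1 := S.integrable_sqrt_leafRatio θ θ'
  have i2 := S.integrable_leafRatio θ θ'
  have e : ∀ y, (1 - √(S.leafRatio θ θ' y)) ^ 2
      = 1 - 2 * √(S.leafRatio θ θ' y) + S.leafRatio θ θ' y := fun y => by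
    nlinarith [Real.sq_sqrt (S.leafRatio_nonneg θ θ' y)]
  have i3 : Integrable (fun y => 1 - 2 * √(S.leafRatio θ θ' y)) (S.law 0 θ) :=
    (integrable_const _).sub (i1.const_mul 2)
  have i4 : Integrable (fun y => (1 - √(S.leafRatio θ θ' y)) ^ 2) (S.law 0 θ) := by
    simp only [e]; exact i3.add i2
  -- The mean square is 1 - 2·affinity + E(ratio), at most 2 - 2·affinity.
  have hle : ∫ y, (1 - √(S.leafRatio θ θ' y)) ^ 2 ∂(S.law 0 θ) ≤ 0 := by
    simp only [e]
    rw [integral_add i3 i2, integral_sub (integrable_const _) (i1.const_mul 2),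
      integral_const_mul]
    have := S.integral_leafRatio_le θ θ'
    change 1 ≤ ∫ y, √(S.leafRatio θ θ' y) ∂(S.law 0 θ) at h
    simp only [integral_const, probReal_univ, smul_eq_mul, one_mul]
    linarith
  have h0 := (integral_eq_zero_iff_of_nonneg (fun y => sq_nonneg _) i4).1
    (le_antisymm hle (integral_nonneg fun _ => sq_nonneg _))
  filter_upwards [h0, S.ae_density_ne_zero 0 θ] with y hy hd
  have hd' : (S.density 0 θ y : ℝ) ≠ 0 := by simpa using hd
  have h1 : √(S.leafRatio θ θ' y) = 1 := by
    have : 1 - √(S.leafRatio θ θ' y) = 0 := by simpa using hy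
    linarith
  have h2 : S.leafRatio θ θ' y = 1 := Real.sqrt_eq_one.1 h1
  have h3 : (S.density 0 θ' y : ℝ) = S.density 0 θ y := (div_eq_one_iff_eq hd').1 h2
  simp only [logRatio, h3]

lemma exp_neg_logRatio {θ : Θ} {y : Y} (h : S.density 0 θ y ≠ 0)
    (h0 : S.density 0 (S.null 0) y ≠ 0) :
    Real.exp (-S.logRatio 0 θ y) = S.leafRatio θ (S.null 0) y := by
  have h' : (0 : ℝ) < S.density 0 θ y := by exact_mod_cast pos_iff_ne_zero.2 h
  have h0' : (0 : ℝ) < S.density 0 (S.null 0) y := by exact_mod_cast pos_iff_ne_zero.2 h0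
  rw [logRatio, Real.exp_neg, Real.exp_log (div_pos h' h0'), inv_div, leafRatio]

/-- The likelihood of the maximum likelihood estimate is not smaller than that of `θ`. -/
lemma one_le_prod_sqrt_leafRatio {S : HierModel Θ Y} (E : S.MLE) {θ : Θ} (hθ : θ ∈ S.anom 0 1) {d : List Y}
    (hd : ∀ y ∈ d, S.density 0 θ y ≠ 0) :
    1 ≤ (d.map fun y => √(S.leafRatio θ (E.est 0 d) y)).prod := by
  have key : ∀ (θ' : Θ) (l : List Y), (l.map fun y => √(S.leafRatio θ θ' y)).prod =
      √(((l.map (S.density 0 θ')).prod : ℝ≥0) / ((l.map (S.density 0 θ)).prod : ℝ≥0)) := by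
    intro θ' l
    induction l with
    | nil => simp
    | cons y l ih =>
      rw [List.map_cons, List.prod_cons, ih, ← Real.sqrt_mul (S.leafRatio_nonneg θ θ' y)]
      simp only [List.map_cons, List.prod_cons, NNReal.coe_mul, leafRatio]
      rw [div_mul_div_comm]
  rw [key, Real.one_le_sqrt]
  have hpos : 0 < (d.map (S.density 0 θ)).prod := by
    refine List.prod_pos fun a ha => ?_
    obtain ⟨y, hy, rfl⟩ := List.mem_map.1 ha
    exact pos_iff_ne_zero.2 (hd y hy)
  rw [one_le_div (by exact_mod_cast hpos)]
  exact_mod_cast E.le_est 0 d θ hθ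

/-- A bound for the expected number of future wrong estimates in a test of a leaf with parameter `θ`
whose samples so far are `d`, where `W` is the set of wrong parameters. -/
noncomputable def errorPotential (W : Finset Θ) (N₀ : ℕ) (θ : Θ) (d : List Y) : ℝ :=
  ∑ θ' ∈ W, (d.map fun y => √(S.leafRatio θ θ' y)).prod *
    (S.affinity θ θ' ^ (N₀ - d.length) / (1 - S.affinity θ θ'))

variable {S}

lemma errorPotential_nonneg {W : Finset Θ} {θ : Θ} (hW : ∀ θ' ∈ W, S.affinity θ θ' < 1)
    (N₀ : ℕ) (d : List Y) : 0 ≤ S.errorPotential W N₀ θ d := by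
  refine Finset.sum_nonneg fun θ' h => mul_nonneg (List.prod_nonneg fun a ha => ?_)
    (div_nonneg (pow_nonneg (S.affinity_nonneg θ θ') _) (by linarith [hW θ' h]))
  obtain ⟨y, _, rfl⟩ := List.mem_map.1 ha
  exact Real.sqrt_nonneg _

lemma errorPotential_append (W : Finset Θ) (N₀ : ℕ) (θ : Θ) (d : List Y) (y : Y) :
    S.errorPotential W N₀ θ (d ++ [y]) = ∑ θ' ∈ W, √(S.leafRatio θ θ' y) *
      ((d.map fun y => √(S.leafRatio θ θ' y)).prod *
        (S.affinity θ θ' ^ (N₀ - (d.length + 1)) / (1 - S.affinity θ θ'))) := by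
  unfold errorPotential
  refine Finset.sum_congr rfl fun θ' _ => ?_
  simp only [List.map_append, List.map_cons, List.map_nil, List.prod_append, List.prod_cons,
    List.prod_nil, List.length_append, List.length_cons, List.length_nil, zero_add, mul_one]
  ring

lemma measurable_errorPotential_append (W : Finset Θ) (N₀ : ℕ) (θ : Θ) (d : List Y) :
    Measurable fun y => S.errorPotential W N₀ θ (d ++ [y]) := by
  simp only [errorPotential_append]
  exact Finset.measurable_sum _ fun θ' _ =>
    (S.measurable_leafRatio θ θ').sqrt.mul_const _

lemma integrable_errorPotential_append (W : Finset Θ) (N₀ : ℕ) (θ : Θ) (d : List Y) :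
    Integrable (fun y => S.errorPotential W N₀ θ (d ++ [y])) (S.law 0 θ) := by
  simp only [errorPotential_append]
  exact integrable_finsetSum _ fun θ' _ => (S.integrable_sqrt_leafRatio θ θ').mul_const _

lemma integral_errorPotential_append (W : Finset Θ) (N₀ : ℕ) (θ : Θ) (d : List Y) :
    ∫ y, S.errorPotential W N₀ θ (d ++ [y]) ∂(S.law 0 θ) =
      ∑ θ' ∈ W, S.affinity θ θ' * ((d.map fun y => √(S.leafRatio θ θ' y)).prod *
        (S.affinity θ θ' ^ (N₀ - (d.length + 1)) / (1 - S.affinity θ θ'))) := by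
  simp only [errorPotential_append]
  rw [integral_finsetSum _ fun θ' _ => (S.integrable_sqrt_leafRatio θ θ').mul_const _]
  refine Finset.sum_congr rfl fun θ' _ => ?_
  rw [integral_mul_const]
  rfl

/-- Estimates count only after the initial phase. The power of the affinity anticipates the
remaining initial samples, so the potential is a martingale until then. -/
lemma integral_errorPotential_append_of_lt (W : Finset Θ) {N₀ : ℕ} (θ : Θ) {d : List Y}
    (h : d.length < N₀) :
    ∫ y, S.errorPotential W N₀ θ (d ++ [y]) ∂(S.law 0 θ) = S.errorPotential W N₀ θ d := by
  rw [integral_errorPotential_append, errorPotential]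
  refine Finset.sum_congr rfl fun θ' _ => ?_
  have : N₀ - d.length = (N₀ - (d.length + 1)) + 1 := by omega
  rw [this, pow_succ]
  ring

lemma integral_errorPotential_append_of_le {W : Finset Θ} {N₀ : ℕ} {θ : Θ}
    (hW : ∀ θ' ∈ W, S.affinity θ θ' < 1) {d : List Y} (h : N₀ ≤ d.length) :
    ∫ y, S.errorPotential W N₀ θ (d ++ [y]) ∂(S.law 0 θ) =
      S.errorPotential W N₀ θ d - ∑ θ' ∈ W, (d.map fun y => √(S.leafRatio θ θ' y)).prod := by
  rw [integral_errorPotential_append, errorPotential, ← Finset.sum_sub_distrib]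
  refine Finset.sum_congr rfl fun θ' hθ' => ?_
  have h1 : N₀ - d.length = 0 := by omega
  have h2 : N₀ - (d.length + 1) = 0 := by omega
  have h3 : 1 - S.affinity θ θ' ≠ 0 := by linarith [hW θ' hθ']
  rw [h1, h2]
  field_simp
  ring

/-- The error potential decreases by one after a wrong estimate. -/
lemma integral_errorPotential_append_le (E : S.MLE) {W : Finset Θ} {N₀ : ℕ} {θ : Θ}
    (hθ : θ ∈ S.anom 0 1) (hW : ∀ θ' ∈ W, S.affinity θ θ' < 1) {d : List Y}
    (hd : ∀ y ∈ d, S.density 0 θ y ≠ 0) (h : N₀ ≤ d.length) :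
    ∫ y, S.errorPotential W N₀ θ (d ++ [y]) ∂(S.law 0 θ) ≤ S.errorPotential W N₀ θ d ∧
    (E.est 0 d ∈ W → ∫ y, S.errorPotential W N₀ θ (d ++ [y]) ∂(S.law 0 θ) + 1
      ≤ S.errorPotential W N₀ θ d) := by
  have h0 : ∀ θ' ∈ W, 0 ≤ (d.map fun y => √(S.leafRatio θ θ' y)).prod := fun θ' _ => by
    refine List.prod_nonneg fun a ha => ?_
    obtain ⟨y, _, rfl⟩ := List.mem_map.1 ha
    exact Real.sqrt_nonneg _
  rw [integral_errorPotential_append_of_le hW h]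
  refine ⟨by linarith [Finset.sum_nonneg h0], fun he => ?_⟩
  -- The product belonging to a wrong estimate is at least 1, because the estimate maximizes the
  -- likelihood; this product is part of what the potential loses.
  have := (one_le_prod_sqrt_leafRatio E hθ hd).trans
    (Finset.single_le_sum (f := fun θ' => (d.map fun y => √(S.leafRatio θ θ' y)).prod) h0 he)
  linarith

/-- Each wrong parameter contributes a geometric tail started at N₀. This limit determines the
threshold for the number of initial samples. -/
lemma tendsto_errorPotential_nil {W : Finset Θ} {θ : Θ} (hW : ∀ θ' ∈ W, S.affinity θ θ' < 1) :
    Filter.Tendsto (fun N₀ => S.errorPotential W N₀ θ ([] : List Y)) Filter.atTop (nhds 0) := by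
  have : Filter.Tendsto (fun N₀ => ∑ θ' ∈ W, (1 : ℝ) *
      (S.affinity θ θ' ^ N₀ / (1 - S.affinity θ θ'))) Filter.atTop
      (nhds (∑ θ' ∈ W, (1 : ℝ) * (0 / (1 - S.affinity θ θ')))) :=
    tendsto_finsetSum _ fun θ' h => ((tendsto_pow_atTop_nhds_zero_of_lt_one
      (S.affinity_nonneg θ θ') (hW θ' h)).div_const _).const_mul _
  simpa [errorPotential] using this

lemma integrable_min_exp (μ : Measure Y) [IsFiniteMeasure μ] {Z : Y → ℝ} (hZ : Measurable Z)
    (s : ℝ) : Integrable (fun y => min 1 (Real.exp (-(s + Z y)))) μ :=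
  Integrable.mono' (integrable_const (1 : ℝ)) (by fun_prop)
    (Filter.Eventually.of_forall fun y => by
      rw [Real.norm_of_nonneg (by positivity)]; exact min_le_left _ _)

/-- The mean of the truncated inverse likelihood ratio after the next sample, which bounds the
probability of the rejection of a target. -/
lemma integral_min_exp_le {θ : Θ} (hac : S.law 0 θ ≪ S.law 0 (S.null 0)) (s : ℝ) :
    ∫ y, min 1 (Real.exp (-(s + S.logRatio 0 θ y))) ∂(S.law 0 θ) ≤ min 1 (Real.exp (-s)) := by
  have hi := integrable_min_exp (S.law 0 θ) (S.measurable_logRatio 0 θ) s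
  refine le_min ?_ ?_
  · calc _ ≤ ∫ _, (1 : ℝ) ∂(S.law 0 θ) :=
        integral_mono hi (integrable_const _) fun y => min_le_left _ _
      _ = 1 := by simp
  · calc _ ≤ ∫ y, Real.exp (-s) * S.leafRatio θ (S.null 0) y ∂(S.law 0 θ) := by
          refine integral_mono_ae hi ((S.integrable_leafRatio _ _).const_mul _) ?_
          filter_upwards [S.ae_density_ne_zero 0 θ, S.ae_density_ne_zero_of_ac hac] with y h1 h2
          refine (min_le_right _ _).trans (le_of_eq ?_)
          rw [← S.exp_neg_logRatio h1 h2, ← Real.exp_add, neg_add]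
      _ ≤ Real.exp (-s) := by
          rw [integral_const_mul]
          exact mul_le_of_le_one_right (Real.exp_pos _).le (S.integral_leafRatio_le _ _)

/-- Equality would force the log-likelihood ratio to be nonpositive almost surely, against its
positive mean. Hence the first counted sample already keeps the rejection bound strictly below 1. -/
lemma integral_min_exp_lt_one {θ : Θ}
    (hpos : 0 < ∫ y, S.logRatio 0 θ y ∂(S.law 0 θ)) :
    ∫ y, min 1 (Real.exp (-S.logRatio 0 θ y)) ∂(S.law 0 θ) < 1 := by
  by_contra h
  push Not at h
  have hi : Integrable (fun y => min 1 (Real.exp (-S.logRatio 0 θ y))) (S.law 0 θ) := by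
    simpa using integrable_min_exp (S.law 0 θ) (S.measurable_logRatio 0 θ) 0
  have hi' : Integrable (fun y => 1 - min 1 (Real.exp (-S.logRatio 0 θ y))) (S.law 0 θ) :=
    (integrable_const _).sub hi
  have hnn : ∀ y, 0 ≤ 1 - min 1 (Real.exp (-S.logRatio 0 θ y)) := fun y =>
    sub_nonneg.2 (min_le_left _ _)
  have h0 : ∫ y, (1 - min 1 (Real.exp (-S.logRatio 0 θ y))) ∂(S.law 0 θ) = 0 := by
    refine le_antisymm ?_ (integral_nonneg hnn)
    rw [integral_sub (integrable_const _) hi]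
    simpa using h
  have hae := (integral_eq_zero_iff_of_nonneg hnn hi').1 h0
  have : ∫ y, S.logRatio 0 θ y ∂(S.law 0 θ) ≤ 0 := by
    refine integral_nonpos_of_ae ?_
    filter_upwards [hae] with y hy
    have h1 : min 1 (Real.exp (-S.logRatio 0 θ y)) = 1 := by
      have : 1 - min 1 (Real.exp (-S.logRatio 0 θ y)) = 0 := hy
      linarith
    have h2 : 1 ≤ Real.exp (-S.logRatio 0 θ y) := min_eq_left_iff.1 h1
    have := Real.one_le_exp_iff.1 h2
    simp only [Pi.zero_apply]; linarith
  linarith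

end HierModel

/-! ### The test of a target -/

namespace HierModel

variable {Θ Y : Type*} [MeasurableSpace Y] {S : HierModel Θ Y} (E : S.MLE)

/-- If the delayed estimate rests on sufficiently many samples, then the test of a target with
threshold `b` costs at most `b / D` plus a constant, in which the cost of a rejection is included.
The constant dominates the cost `a` of the return to the target after a rejection. -/
theorem exists_leafPotential_target (hfin : (S.anom 0 1).Finite) {θ : Θ} (hθ : θ ∈ S.anom 0 1)
    {Δ V : ℝ} (hΔ : 0 < Δ) (hac : S.law 0 θ ≪ S.law 0 (S.null 0))
    (hL2 : ∀ θ' ∈ S.anom 0 1, MemLp (S.logRatio 0 θ') 2 (S.law 0 θ))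
    (hV : ∀ θ' ∈ S.anom 0 1, ∫ y, S.logRatio 0 θ' y ^ 2 ∂(S.law 0 θ) ≤ V)
    (hmean : Δ ≤ ∫ y, S.logRatio 0 θ y ∂(S.law 0 θ)) :
    ∃ N₁ : ℕ, ∀ N₀, N₁ ≤ N₀ → ∀ a : ℝ, 0 ≤ a → ∃ A₀ : ℝ, ∀ A, A₀ ≤ A → 0 ≤ A → ∀ D b : ℝ, Δ ≤ D →
      D ≤ ∫ y, S.logRatio 0 θ y ∂(S.law 0 θ) → 0 ≤ b →
      ∃ Ψ : List Y → ℝ≥0∞, Ψ [] ≤ ENNReal.ofReal (b / D + A) ∧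
        LeafPotential E N₀ b (S.law 0 θ) (ENNReal.ofReal (b / D + A + a)) Ψ := by
  classical
  set μ := S.law 0 θ
  set Z := S.logRatio 0 θ
  set m : ℝ := ∫ y, min 1 (Real.exp (-Z y)) ∂μ with hm
  have hm1 : m < 1 := integral_min_exp_lt_one (hΔ.trans_le hmean)
  have hm0 : 0 ≤ m := integral_nonneg fun y => by positivity
  have hV0 : 0 ≤ V := le_trans (integral_nonneg fun _ => sq_nonneg _) (hV θ hθ)
  -- Parameters with the same distribution as θ are not wrong: they yield the same log-likelihood
  -- ratio almost surely.
  set W : Finset Θ := hfin.toFinset.filter fun θ' => S.affinity θ θ' < 1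
  have hW : ∀ θ' ∈ W, S.affinity θ θ' < 1 := fun θ' h => (Finset.mem_filter.1 h).2
  -- With correct estimates the rejection bound is m; wrong estimates may add at most (1 - m)/2,
  -- which keeps the total below 1.
  obtain ⟨N₁, hN₁⟩ := Filter.eventually_atTop.1
    ((tendsto_errorPotential_nil (S := S) hW).eventually_lt_const
      (show (0 : ℝ) < (1 - m) / 2 by linarith))
  -- The target height is raised by β so that the mean excess is at most V / (4β) ≤ Δ/2 as long as
  -- the test continues.
  set β : ℝ := V / (2 * Δ) + 1 with hβ
  have hβ0 : 0 < β := by positivity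
  -- One wrong estimate may raise the passage potential by 2/Δ · (1 + V), and its sample costs 1.
  set κ : ℝ := 2 / Δ * (1 + V) + 1 with hκ
  have hκ0 : 0 ≤ κ := by positivity
  -- A recurs in the cost of a rejection, with total factor at most m + (1 - m)/2. The remaining
  -- share (1 - m)/2 of A has to pay for all other constants.
  refine ⟨N₁, fun N₀ hN₀ a ha => ⟨(N₀ + β / Δ + V / Δ ^ 2 + a + κ) / ((1 - m) / 2),
    fun A hA hA0 D b hΔD hD hb => ?_⟩⟩
  have hD0 : 0 < D := hΔ.trans_le hΔD
  set c : ℝ := 2 / Δ ^ 2 with hc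
  have hc0 : 0 ≤ c := by positivity
  have hexc : ∀ y, β ≤ y → meanExcess μ Z y ≤ Δ / 2 := fun y hy => by
    have hy0 : 0 < y := hβ0.trans_le hy
    refine (meanExcess_le (hL2 θ hθ) (hV θ hθ) hy0).trans ?_
    rw [div_le_iff₀ (by positivity)]
    have h1 : Δ * β ≤ Δ * y := by gcongr
    have h2 : Δ * β = V / 2 + Δ := by rw [hβ]; field_simp
    nlinarith
  set H : ℝ → ℝ := passagePotential μ Z D c V
  have hHge : ∀ y, 0 ≤ y → y / D ≤ H y := fun y hy =>
    le_passagePotential (hL2 θ hθ) hc0 (hV θ hθ) hy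
  have hHle : ∀ y, H y ≤ y / D + V / Δ ^ 2 := fun y => by
    have := passagePotential_le (μ := μ) (Z := Z) (D := D) (V := V) hc0 y
    have e : c / 2 * V = V / Δ ^ 2 := by rw [hc]; field_simp
    linarith
  -- At sum 0 the bound min(1, exp(-sum)) would be the useless 1. Up to the first counted sample it
  -- is therefore replaced by its mean m after that sample.
  set r : List Y → ℝ := fun d =>
    if d.length ≤ N₀ then m else min 1 (Real.exp (-allr E N₀ d)) with hr
  have hr0 : ∀ d, 0 ≤ r d := fun d => by
    simp only [hr]; split_ifs
    · exact hm0
    · positivity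
  set Λ : List Y → ℝ := S.errorPotential W N₀ θ with hΛ
  have hΛ0 : ∀ d, 0 ≤ Λ d := errorPotential_nonneg hW N₀
  -- Initial samples left, time to passage, risk of rejection times its price, and expected wrong
  -- estimates times theirs.
  set Q : List Y → ℝ := fun d => ((N₀ - d.length : ℕ) : ℝ) + H (b - allr E N₀ d + β) +
    (A + a) * r d + (A + a + κ) * Λ d with hQ
  -- Samples outside the support of θ have probability 0 and get the value ∞, since the likelihood
  -- comparison fails there.
  refine ⟨fun d => if ∀ y ∈ d, S.density 0 θ y ≠ 0 then ENNReal.ofReal (Q d) else ∞, ?_, ?_⟩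
  · have h1 : Λ [] < (1 - m) / 2 := hN₁ N₀ hN₀
    have h2 : N₀ + β / Δ + V / Δ ^ 2 + a + κ ≤ A * ((1 - m) / 2) :=
      (div_le_iff₀ (by linarith)).1 hA
    have h3 : β / D ≤ β / Δ := by gcongr
    have h4 := hHle (b + β)
    have h5 : (b + β) / D = b / D + β / D := add_div _ _ _
    have h6 : (A + a + κ) * Λ [] ≤ (A + a + κ) * ((1 - m) / 2) := by gcongr
    simp only [List.not_mem_nil, false_implies, implies_true, if_true]
    refine ENNReal.ofReal_le_ofReal ?_
    simp only [hQ, hr, List.length_nil, Nat.zero_le, if_true, allr_eq_zero E N₀ (d := []) (by simp),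
      sub_zero, Nat.sub_zero]
    nlinarith
  intro d hd
  by_cases hgood : ∀ y ∈ d, S.density 0 θ y ≠ 0
  swap
  · exact ⟨fun _ => ∞, measurable_const, by simp [hgood], by simp⟩
  have hgood' : ∀ y, S.density 0 θ y ≠ 0 → ∀ z ∈ d ++ [y], S.density 0 θ z ≠ 0 := by
    intro y hy z hz
    rcases List.mem_append.1 hz with h | h
    · exact hgood z h
    · rwa [List.mem_singleton.1 h]
  have hΛm : Measurable fun y => Λ (d ++ [y]) := measurable_errorPotential_append W N₀ θ d
  have hΛi : Integrable (fun y => Λ (d ++ [y])) μ := integrable_errorPotential_append W N₀ θ d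
  simp only [if_pos hgood]
  rcases lt_or_ge d.length N₀ with hlt | hge
  · have hnn : 0 ≤ H (b + β) := le_trans (by positivity) (hHge (b + β) (by positivity))
    have i5 : Integrable (fun y => ((N₀ - (d.length + 1) : ℕ) : ℝ) + H (b + β) + (A + a) * m +
      (A + a + κ) * Λ (d ++ [y])) μ := (integrable_const _).add (hΛi.const_mul _)
    refine ⟨fun y => ENNReal.ofReal (((N₀ - (d.length + 1) : ℕ) : ℝ) + H (b + β) + (A + a) * m +
      (A + a + κ) * Λ (d ++ [y])), (measurable_const.add (hΛm.const_mul _)).ennreal_ofReal,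
      one_add_lintegral_ofReal_le i5 (fun y => ?_) ?_, ?_⟩
    · have := hΛ0 (d ++ [y]); positivity
    · rw [integral_add (integrable_const _) (hΛi.const_mul _), integral_const_mul,
        integral_errorPotential_append_of_lt W θ hlt]
      have : N₀ - d.length = (N₀ - (d.length + 1)) + 1 := by omega
      simp only [hQ, hr, if_pos hlt.le, allr_eq_zero E N₀ hlt.le, sub_zero, this, integral_const,
        probReal_univ, smul_eq_mul, one_mul]
      push_cast
      linarith
    · filter_upwards [S.ae_density_ne_zero 0 θ] with y hy
      have hl : (d ++ [y]).length ≤ N₀ := by simp; omega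
      rw [leafCost, if_pos hl, if_pos (hgood' y hy)]
      simp only [hQ, hr, if_pos hl, allr_eq_zero E N₀ hl, sub_zero]
      simp
  · set s := allr E N₀ d with hs
    have hs0 : 0 ≤ s ∧ s ≤ b := by
      rcases hd with h | h
      · rw [hs, allr_eq_zero E N₀ h]; exact ⟨le_rfl, hb⟩
      · exact h
    have hmem := E.mem 0 d
    have hmZ := S.measurable_logRatio 0 (E.est 0 d)
    set Z' := S.logRatio 0 (E.est 0 d)
    set y₀ : ℝ := b - s + β with hy₀
    have hyβ : β ≤ y₀ := by rw [hy₀]; linarith [hs0.2]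
    have htan : ∀ z, H (y₀ - z) ≤ passageTangent μ Z D c V y₀ z := fun z =>
      passagePotential_le_tangent (hL2 θ hθ) hD0 hc0 y₀ z
    have htan0 : ∀ z, 0 ≤ passageTangent μ Z D c V y₀ z := fun z =>
      passageTangent_nonneg (hL2 θ hθ) hD0 hc0 (hV θ hθ) y₀ z
    have i1 : Integrable (fun y => passageTangent μ Z D c V y₀ (Z' y)) μ :=
      integrable_passageTangent (hL2 _ hmem) D c V y₀
    have i2 : Integrable (fun y => (A + a) * min 1 (Real.exp (-(s + Z' y)))) μ :=
      (integrable_min_exp μ hmZ s).const_mul _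
    have i3 : Integrable (fun y => passageTangent μ Z D c V y₀ (Z' y) +
      (A + a) * min 1 (Real.exp (-(s + Z' y)))) μ := i1.add i2
    have i4 : Integrable (fun y => (A + a + κ) * Λ (d ++ [y])) μ := hΛi.const_mul _
    have i6 : Integrable (fun y => passageTangent μ Z D c V y₀ (Z' y) +
      (A + a) * min 1 (Real.exp (-(s + Z' y))) + (A + a + κ) * Λ (d ++ [y])) μ := i3.add i4
    have hQd : Q d = H y₀ + (A + a) * r d + (A + a + κ) * Λ d := by
      have : N₀ - d.length = 0 := by omega
      simp only [hQ, this, hy₀, hs]; push_cast; ring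
    have hΛstep := integral_errorPotential_append_le E hθ hW hgood hge
    have hAa : 0 ≤ A + a := by positivity
    refine ⟨fun y => ENNReal.ofReal (passageTangent μ Z D c V y₀ (Z' y) +
      (A + a) * min 1 (Real.exp (-(s + Z' y))) + (A + a + κ) * Λ (d ++ [y])), ?_,
      one_add_lintegral_ofReal_le i6 (fun y => ?_) ?_, ?_⟩
    · refine (Measurable.add ?_ (hΛm.const_mul _)).ennreal_ofReal
      unfold passageTangent
      fun_prop
    · have h1 := hΛ0 (d ++ [y])
      have h2 := htan0 (Z' y)
      positivity
    · rw [integral_add i3 i4, integral_add i1 i2, integral_const_mul, integral_const_mul, hQd]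
      by_cases hest : E.est 0 d ∈ W
      · have h1 := integral_passageTangent_le_add (Z := Z) (hL2 _ hmem) hΔ hΔD (hV _ hmem)
          (hβ0.le.trans hyβ) (hexc y₀ hyβ)
        have h2 : ∫ y, min 1 (Real.exp (-(s + Z' y))) ∂μ ≤ 1 := by
          calc _ ≤ ∫ _, (1 : ℝ) ∂μ := integral_mono (integrable_min_exp μ hmZ s)
                (integrable_const _) fun y => min_le_left _ _
            _ = 1 := by simp
        have h3 := mul_le_mul_of_nonneg_left (hΛstep.2 hest) (by positivity : 0 ≤ A + a + κ)
        have h4 := mul_le_mul_of_nonneg_left h2 hAa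
        have h5 := mul_nonneg hAa (hr0 d)
        rw [mul_add, mul_one] at h3
        linarith
      -- Outside W the estimate may be replaced by θ inside the integrals.
      · have haff : 1 ≤ S.affinity θ (E.est 0 d) := by
          by_contra h
          exact hest (Finset.mem_filter.2 ⟨hfin.mem_toFinset.2 hmem, not_le.1 h⟩)
        have hae : Z' =ᵐ[μ] Z := S.logRatio_ae_eq_of_affinity haff
        have e1 : ∫ y, passageTangent μ Z D c V y₀ (Z' y) ∂μ =
            ∫ y, passageTangent μ Z D c V y₀ (Z y) ∂μ :=
          integral_congr_ae (hae.mono fun y hy => by simp only [hy])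
        have e2 : ∫ y, min 1 (Real.exp (-(s + Z' y))) ∂μ =
            ∫ y, min 1 (Real.exp (-(s + Z y))) ∂μ :=
          integral_congr_ae (hae.mono fun y hy => by simp only [hy])
        have h1 := integral_passageTangent_le (V := V) (hL2 θ hθ) hΔ hΔD hD (hexc y₀ hyβ)
        have h2 : ∫ y, min 1 (Real.exp (-(s + Z y))) ∂μ ≤ r d := by
          simp only [hr]
          split_ifs with hl
          · have : s = 0 := allr_eq_zero E N₀ hl
            simp [this, hm]
          · exact integral_min_exp_le hac s
        have h3 := mul_le_mul_of_nonneg_left hΛstep.1 (by positivity : 0 ≤ A + a + κ)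
        have h4 := mul_le_mul_of_nonneg_left h2 hAa
        rw [e1, e2]
        linarith
    · filter_upwards [S.ae_density_ne_zero 0 θ] with y hy
      have hl : ¬ (d ++ [y]).length ≤ N₀ := by simp; omega
      have hall : allr E N₀ (d ++ [y]) = s + Z' y := by rw [allr_append, if_pos hge]
      have h1 : 0 ≤ (A + a + κ) * Λ (d ++ [y]) := mul_nonneg (by positivity) (hΛ0 _)
      have hy' : b - (s + Z' y) + β = y₀ - Z' y := by rw [hy₀]; ring
      rw [leafCost, if_neg hl, hall, if_pos (hgood' y hy)]
      split_ifs with hacc hrej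
      · simp
      · refine ENNReal.ofReal_le_ofReal ?_
        -- At a rejection the sum is negative: the risk term has become the full A + a, and the
        -- passage potential is still at least b/D. Together they cover v.
        have h2 : min 1 (Real.exp (-(s + Z' y))) = 1 :=
          min_eq_left (Real.one_le_exp (by linarith))
        have h3 : b / D ≤ H (y₀ - Z' y) := by
          refine le_trans ?_ (hHge _ (by rw [← hy']; linarith))
          gcongr
          rw [← hy']; linarith
        rw [h2]
        linarith [htan (Z' y)]
      · refine ENNReal.ofReal_le_ofReal ?_
        have : N₀ - (d ++ [y]).length = 0 := by simp; omega
        simp only [hQ, hr, if_neg hl, hall, this, hy']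
        push_cast
        linarith [htan (Z' y)]

end HierModel

/-! ### Measurability and iterated means over the samples of an internal test -/

/-- A function of finite samples is measurable in the samples of every size. -/
def ListMeasurable {Y β : Type*} [MeasurableSpace Y] [MeasurableSpace β] (F : List Y → β) : Prop :=
  ∀ n, Measurable fun x : Fin n → Y => F (List.ofFn x)

section ListMeasurable

variable {Y β : Type*} [MeasurableSpace Y] [MeasurableSpace β] {F : List Y → β}

lemma ListMeasurable.append (hF : ListMeasurable F) (m n : ℕ) :
    Measurable fun p : (Fin m → Y) × (Fin n → Y) => F (List.ofFn p.1 ++ List.ofFn p.2) := by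
  have h : Measurable fun p : (Fin m → Y) × (Fin n → Y) => Fin.append p.1 p.2 := by
    refine measurable_pi_iff.2 fun i => ?_
    induction i using Fin.addCases with
    | left i => simpa [Function.comp_def] using (measurable_pi_apply i).comp measurable_fst
    | right i => simpa [Function.comp_def] using (measurable_pi_apply i).comp measurable_snd
  simpa only [Function.comp_def, List.ofFn_fin_append] using (hF (m + n)).comp h

lemma ListMeasurable.const_append (hF : ListMeasurable F) (d : List Y) (n : ℕ) :
    Measurable fun x : Fin n → Y => F (d ++ List.ofFn x) := by
  have := (hF.append d.length n).comp (measurable_prodMk_left (x := d.get))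
  simpa only [Function.comp_def, List.ofFn_get] using this

lemma ListMeasurable.append_singleton (hF : ListMeasurable F) (n : ℕ) :
    Measurable fun p : (Fin n → Y) × Y => F (List.ofFn p.1 ++ [p.2]) := by
  have h : Measurable fun p : (Fin n → Y) × Y => (p.1, fun _ : Fin 1 => p.2) := by fun_prop
  simpa [Function.comp_def] using (hF.append n 1).comp h

lemma ListMeasurable.const_append_singleton (hF : ListMeasurable F) (d : List Y) :
    Measurable fun y => F (d ++ [y]) := by
  have := (hF.append_singleton d.length).comp (measurable_prodMk_left (x := d.get))
  simpa only [Function.comp_def, List.ofFn_get] using this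

lemma ListMeasurable.take (hF : ListMeasurable F) (k : ℕ) :
    ListMeasurable fun d => F (d.take k) := by
  intro n
  have h : Measurable fun (x : Fin n → Y) (i : Fin (min k n)) => x ⟨i, by omega⟩ :=
    measurable_pi_iff.2 fun i => measurable_pi_apply _
  convert (hF (min k n)).comp h using 2 with x
  simp only [Function.comp]
  congr 1
  refine List.ext_getElem (by simp) fun i h1 h2 => ?_
  simp

lemma ListMeasurable.drop (hF : ListMeasurable F) (k : ℕ) :
    ListMeasurable fun d => F (d.drop k) := by
  intro n
  have h : Measurable fun (x : Fin n → Y) (i : Fin (n - k)) => x ⟨k + i, by omega⟩ :=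
    measurable_pi_iff.2 fun i => measurable_pi_apply _
  convert (hF (n - k)).comp h using 2 with x
  simp only [Function.comp]
  congr 1
  refine List.ext_getElem (by simp) fun i h1 h2 => ?_
  simp

/-- The mean of `F` after the samples `d` and `m` further samples, where `μ k` is the distribution
of the sample number `k`. -/
noncomputable def iteratedMean (μ : ℕ → Measure Y) (F : List Y → ℝ≥0∞) : ℕ → List Y → ℝ≥0∞
  | 0, d => F d
  | m + 1, d => ∫⁻ y, iteratedMean μ F m (d ++ [y]) ∂(μ d.length)

lemma ListMeasurable.iteratedMean {μ : ℕ → Measure Y} [∀ k, SFinite (μ k)] {F : List Y → ℝ≥0∞}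
    (hF : ListMeasurable F) (m : ℕ) : ListMeasurable (iteratedMean μ F m) := by
  induction m with
  | zero => exact hF
  | succ m ih =>
    intro n
    simp only [_root_.iteratedMean, List.length_ofFn]
    exact (ih.append_singleton n).lintegral_prod_right'

/-- Samples with a common law merge into one integral over a product measure. This connects the
sample-by-sample potential with the probability in `HierModel.ReliableTest`. -/
lemma iteratedMean_add {μ : ℕ → Measure Y} [∀ k, SFinite (μ k)] {F : List Y → ℝ≥0∞}
    (hF : ListMeasurable F) (ν : Measure Y) [SigmaFinite ν] (n m : ℕ) (d : List Y)
    (hν : ∀ k, d.length ≤ k → k < d.length + n → μ k = ν) :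
    iteratedMean μ F (n + m) d =
      ∫⁻ x, iteratedMean μ F m (d ++ List.ofFn x) ∂(Measure.pi fun _ : Fin n => ν) := by
  induction n generalizing d with
  | zero =>
    rw [Measure.pi_of_empty, lintegral_dirac]
    simp
  | succ n ih =>
    have h1 : n + 1 + m = (n + m) + 1 := by omega
    rw [h1, iteratedMean, hν d.length le_rfl (by omega)]
    have hG := hF.iteratedMean (μ := μ) m
    have hmp := measurePreserving_piFinSuccAbove (fun _ : Fin (n + 1) => ν) 0
    have hmeas : Measurable fun p : Y × (Fin n → Y) =>
        iteratedMean μ F m (d ++ [p.1] ++ List.ofFn p.2) := by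
      have h : Measurable fun p : Y × (Fin n → Y) =>
          (Fin.cons p.1 p.2 : Fin (n + 1) → Y) := by
        refine measurable_pi_iff.2 fun i => ?_
        induction i using Fin.cases with
        | zero => simpa using measurable_fst
        | succ i => simpa [Function.comp_def] using (measurable_pi_apply i).comp measurable_snd
      have := (hG.const_append d (n + 1)).comp h
      simpa [Function.comp_def, List.ofFn_succ] using this
    calc ∫⁻ y, iteratedMean μ F (n + m) (d ++ [y]) ∂ν
        = ∫⁻ y, ∫⁻ x, iteratedMean μ F m (d ++ [y] ++ List.ofFn x)
            ∂(Measure.pi fun _ : Fin n => ν) ∂ν :=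
          lintegral_congr fun y => ih (d ++ [y]) fun k hk hk' => by
            simp only [List.length_append, List.length_singleton] at hk hk'
            exact hν k (by omega) (by omega)
      _ = ∫⁻ p, iteratedMean μ F m (d ++ [p.1] ++ List.ofFn p.2)
            ∂(ν.prod (Measure.pi fun _ : Fin n => ν)) :=
          (lintegral_prod _ hmeas.aemeasurable).symm
      _ = _ := by
          rw [← hmp.lintegral_comp hmeas]
          refine lintegral_congr fun x => ?_
          simp [List.ofFn_succ, MeasurableEquiv.piFinSuccAbove_apply, Fin.tail_def]

/-- The mean over two successive samples with the distributions `ν₁` and `ν₂`. -/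
lemma iteratedMean_two_samples {F : List Y → ℝ≥0∞} (hF : ListMeasurable F) (ν₁ ν₂ : Measure Y)
    [SigmaFinite ν₁] [SigmaFinite ν₂] (n₁ n₂ : ℕ) :
    iteratedMean (fun k => if k < n₁ then ν₁ else ν₂) F (n₁ + n₂) [] =
      ∫⁻ p, F (List.ofFn p.1 ++ List.ofFn p.2)
        ∂((Measure.pi fun _ : Fin n₁ => ν₁).prod (Measure.pi fun _ : Fin n₂ => ν₂)) := by
  have : ∀ k, SFinite (if k < n₁ then ν₁ else ν₂) := fun k => by split_ifs <;> infer_instance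
  rw [iteratedMean_add hF ν₁ n₁ n₂ [] fun k _ hk => if_pos (by simpa using hk),
    lintegral_prod _ (hF.append n₁ n₂).aemeasurable]
  refine lintegral_congr fun x => ?_
  rw [← add_zero n₂, iteratedMean_add hF ν₂ n₂ 0 _ fun k hk _ => if_neg (by simpa using hk)]
  rfl

end ListMeasurable

namespace HierModel

variable {Θ Y : Type*} [MeasurableSpace Y] {S : HierModel Θ Y} (E : S.MLE)

/-- Only the level sets of the estimator are measurable by assumption; its range is finite, so the
statistic is a finite sum over these sets. -/
lemma listMeasurable_gllr {l : ℕ} (hf : (S.anom l 1).Finite) : ListMeasurable (gllr E l) := by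
  classical
  intro n
  have h : (fun x : Fin n → Y => gllr E l (List.ofFn x)) = fun x =>
      ∑ θ ∈ hf.toFinset, {x : Fin n → Y | E.est l (List.ofFn x) = θ}.indicator
        (fun x => ∑ i, S.logRatio l θ (x i)) x := by
    ext x
    rw [gllr_ofFn, Finset.sum_eq_single (E.est l (List.ofFn x))]
    · rw [Set.indicator_of_mem]
      exact rfl
    · intro θ _ hθ
      exact Set.indicator_of_notMem (fun h => hθ h.symm) _
    · intro h
      exact absurd (hf.mem_toFinset.2 (E.mem l _)) h
  rw [h]
  refine Finset.measurable_sum _ fun θ _ => Measurable.indicator ?_ (E.measurableSet_est l n θ)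
  exact Finset.measurable_sum _ fun i _ =>
    (S.measurable_logRatio l θ).comp (measurable_pi_apply i)

end HierModel

lemma internalMove_correct_iff (jL jR : ℕ) (u v : ℝ) :
    (internalMove u v).Correct jL jR ↔ ((u ≤ 0 ∧ v ≤ 0) ∧ (jL = 0 ∧ jR = 0)) ∨
      (¬ (u ≤ 0 ∧ v ≤ 0) ∧ ((v ≤ u ∧ 0 < jL) ∨ (¬ v ≤ u ∧ 0 < jR))) := by
  unfold internalMove
  split_ifs with h1 h2 <;> simp [HDSMove.Correct, *]

lemma measurableSet_internalMove_correct {α : Type*} [MeasurableSpace α] {u v : α → ℝ}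
    (hu : Measurable u) (hv : Measurable v) (jL jR : ℕ) :
    MeasurableSet {x | (internalMove (u x) (v x)).Correct jL jR} := by
  simp only [internalMove_correct_iff]
  have h1 : MeasurableSet {x | u x ≤ 0 ∧ v x ≤ 0} :=
    (measurableSet_le hu measurable_const).inter (measurableSet_le hv measurable_const)
  have h2 : MeasurableSet {x | v x ≤ u x} := measurableSet_le hv hu
  exact (h1.inter (.const _)).union (h1.compl.inter
    ((h2.inter (.const _)).union (h2.compl.inter (.const _))))

/-! ### Distances in the tree and moves of the walk -/

/-- The node `(l, i)` contains an element of `T`. -/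
def HasTarget (T : Finset ℕ) (l i : ℕ) : Prop := ∃ m ∈ T, m / 2 ^ l = i

/-- The distance of the node `(l, i)` from the closest element of `T` in the tree: the walk has to
climb to the first ancestor that contains an element of `T`, and then to descend to the leaves. -/
noncomputable def targetDist (T : Finset ℕ) (l i : ℕ) : ℕ :=
  l + 2 * sInf {k | HasTarget T (l + k) (i / 2 ^ k)}

section targetDist

variable {T : Finset ℕ} {l i : ℕ}

lemma div_two_pow_succ (m l : ℕ) : m / 2 ^ (l + 1) = m / 2 ^ l / 2 := by
  rw [Nat.div_div_eq_div_mul, pow_succ]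

lemma HasTarget.parent (h : HasTarget T l i) : HasTarget T (l + 1) (i / 2) := by
  obtain ⟨m, hm, rfl⟩ := h
  exact ⟨m, hm, div_two_pow_succ m l⟩

lemma hasTarget_iff_card {T : Finset ℕ} {l i : ℕ} :
    HasTarget T l i ↔ 0 < (T.filter fun m => m / 2 ^ l = i).card := by
  simp [Finset.card_pos, Finset.Nonempty, HasTarget]

lemma HasTarget.child (h : HasTarget T (l + 1) i) :
    HasTarget T l (2 * i) ∨ HasTarget T l (2 * i + 1) := by
  obtain ⟨m, hm, hmi⟩ := h
  rw [div_two_pow_succ] at hmi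
  have : m / 2 ^ l = 2 * i ∨ m / 2 ^ l = 2 * i + 1 := by omega
  rcases this with h | h
  · exact Or.inl ⟨m, hm, h⟩
  · exact Or.inr ⟨m, hm, h⟩

lemma targetDist_of_hasTarget (h : HasTarget T l i) : targetDist T l i = l := by
  have : sInf {k | HasTarget T (l + k) (i / 2 ^ k)} = 0 :=
    Nat.sInf_eq_zero.2 (Or.inl (by simpa using h))
  rw [targetDist, this]; rfl

/-- The witness `k` excludes the infimum of the empty set, which would be the default value 0. -/
lemma targetDist_of_not_hasTarget {k : ℕ} (hk : HasTarget T (l + k) (i / 2 ^ k))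
    (h : ¬ HasTarget T l i) : targetDist T l i = targetDist T (l + 1) (i / 2) + 1 := by
  classical
  have hiff : ∀ k, HasTarget T (l + (k + 1)) (i / 2 ^ (k + 1)) ↔
      HasTarget T (l + 1 + k) (i / 2 / 2 ^ k) := fun k => by
    rw [Nat.div_div_eq_div_mul, ← pow_succ', add_assoc, add_comm 1 k]
  obtain ⟨k, rfl⟩ : ∃ j, k = j + 1 := by
    cases k with
    | zero => exact absurd (by simpa using hk) h
    | succ j => exact ⟨j, rfl⟩
  have h1 : {k | HasTarget T (l + k) (i / 2 ^ k)}.Nonempty := ⟨k + 1, hk⟩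
  have h2 : {k | HasTarget T (l + 1 + k) (i / 2 / 2 ^ k)}.Nonempty := ⟨k, (hiff k).1 hk⟩
  have h3 : sInf {k | HasTarget T (l + k) (i / 2 ^ k)} =
      sInf {k | HasTarget T (l + 1 + k) (i / 2 / 2 ^ k)} + 1 := by
    refine le_antisymm (Nat.sInf_le ((hiff _).2 (Nat.sInf_mem h2))) ?_
    have hmem := Nat.sInf_mem h1
    cases hs : sInf {k | HasTarget T (l + k) (i / 2 ^ k)} with
    | zero => rw [hs] at hmem; exact absurd (by simpa using hmem) h
    | succ j =>
      rw [hs] at hmem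
      exact Nat.succ_le_succ (Nat.sInf_le ((hiff j).1 hmem))
  unfold targetDist
  omega

end targetDist

namespace HDSParams

variable {Θ Y : Type*} [MeasurableSpace Y] {S : HierModel Θ Y} (A : HDSParams) (E : S.MLE)

lemma alive_parent {R : Finset ℕ} {l i : ℕ} (h : A.Alive R l i) : A.Alive R (l + 1) (i / 2) := by
  obtain ⟨m, hm, hmR, rfl⟩ := h
  exact ⟨m, hm, hmR, div_two_pow_succ m l⟩

lemma alive_child {R : Finset ℕ} {l i : ℕ} (h : A.Alive R (l + 1) i) :
    A.Alive R l (2 * i) ∨ A.Alive R l (2 * i + 1) := by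
  obtain ⟨m, hm, hmR, hmi⟩ := h
  rw [div_two_pow_succ] at hmi
  have : m / 2 ^ l = 2 * i ∨ m / 2 ^ l = 2 * i + 1 := by omega
  rcases this with h | h
  · exact Or.inl ⟨m, hm, hmR, h⟩
  · exact Or.inr ⟨m, hm, hmR, h⟩

lemma alive_root {R : Finset ℕ} (h : R.card < 2 ^ A.L) : A.Alive R A.L 0 := by
  obtain ⟨m, hm, hmR⟩ := Finset.exists_mem_notMem_of_card_lt_card
    (show R.card < (Finset.range (2 ^ A.L)).card by simpa using h)
  have hm' := Finset.mem_range.1 hm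
  exact ⟨m, hm', hmR, Nat.div_eq_of_lt hm'⟩

lemma alive_of_hasTarget {H R : Finset ℕ} (hH : H ⊆ Finset.range (2 ^ A.L)) {l i : ℕ}
    (h : HasTarget (H \ R) l i) : A.Alive R l i := by
  obtain ⟨m, hm, hmi⟩ := h
  obtain ⟨h1, h2⟩ := Finset.mem_sdiff.1 hm
  exact ⟨m, Finset.mem_range.1 (hH h1), h2, hmi⟩

/-- On level L all leaves of the tree lie below index 0. Aliveness serves only to place the node
inside the tree. -/
lemma hasTarget_ancestor {T : Finset ℕ} (hT : T ⊆ Finset.range (2 ^ A.L)) (hne : T.Nonempty)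
    {R : Finset ℕ} {l i : ℕ} (hl : l ≤ A.L) (h : A.Alive R l i) :
    HasTarget T (l + (A.L - l)) (i / 2 ^ (A.L - l)) := by
  obtain ⟨m, hm, _, rfl⟩ := h
  obtain ⟨t, ht⟩ := hne
  have ht' := Finset.mem_range.1 (hT ht)
  refine ⟨t, ht, ?_⟩
  rw [Nat.div_div_eq_div_mul, ← pow_add, Nat.add_sub_cancel' hl, Nat.div_eq_of_lt ht',
    Nat.div_eq_of_lt hm]

lemma hasTarget_root {T : Finset ℕ} (hT : T ⊆ Finset.range (2 ^ A.L)) (hne : T.Nonempty)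
    {R : Finset ℕ} {i : ℕ} (h : A.Alive R A.L i) : HasTarget T A.L i := by
  simpa using A.hasTarget_ancestor hT hne le_rfl h

lemma pos_of_internalMove_left {gL gR : ℝ} (h : internalMove gL gR = .left) : 0 < gL := by
  unfold internalMove at h
  split_ifs at h with h1 h2
  by_contra h3
  exact h1 ⟨by linarith, by linarith⟩

lemma pos_of_internalMove_right {gL gR : ℝ} (h : internalMove gL gR = .right) : 0 < gR := by
  unfold internalMove at h
  split_ifs at h with h1 h2
  by_contra h3
  exact h1 ⟨by linarith, by linarith⟩

lemma alive_of_childSize_pos {R : Finset ℕ} {l i : ℕ} (h : 0 < A.childSize R l i) :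
    A.Alive R l i := by
  unfold childSize at h
  split_ifs at h with h1
  · exact h1
  · omega

/-- The node that is reached after an internal test. -/
def nextState (R : Finset ℕ) (l i : ℕ) : HDSMove → HDSState Y
  | .left => ⟨R, l, 2 * i, []⟩
  | .right => ⟨R, l, 2 * i + 1, []⟩
  | .parent => A.toParent R (l + 1) i

lemma internalStep_of_length {R : Finset ℕ} {l i : ℕ} {d : List Y}
    (h : d.length = A.childSize R l (2 * i) + A.childSize R l (2 * i + 1)) :
    A.internalStep E R l i d = A.nextState R l i
      (internalMove (HierModel.gllr E l (d.take (A.childSize R l (2 * i))))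
        (HierModel.gllr E l (d.drop (A.childSize R l (2 * i))))) := by
  rw [internalStep, if_neg (by omega)]
  cases internalMove (HierModel.gllr E l (d.take (A.childSize R l (2 * i))))
        (HierModel.gllr E l (d.drop (A.childSize R l (2 * i)))) <;> rfl

/-- The state is the beginning of a local test at a node of the tree. -/
def IsNode (R : Finset ℕ) (s : HDSState Y) : Prop :=
  s.removed = R ∧ s.data = [] ∧ s.level ≤ A.L ∧ A.Alive R s.level s.index

lemma isNode_toParent {Y : Type*} {R : Finset ℕ} {l i : ℕ} (hl : l ≤ A.L) (h : A.Alive R l i) :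
    A.IsNode R (A.toParent R l i : HDSState Y) := by
  unfold toParent
  split_ifs with h1
  · exact ⟨rfl, rfl, h1, A.alive_parent h⟩
  · exact ⟨rfl, rfl, hl, h⟩

/-- The walk never enters an emptied subtree: its statistic is that of the empty sample, hence 0,
while a move to a child requires a positive one. -/
lemma isNode_internalStep {R : Finset ℕ} {l i : ℕ} (hl : l + 1 ≤ A.L) (h : A.Alive R (l + 1) i)
    {d : List Y} (hd : d.length = A.childSize R l (2 * i) + A.childSize R l (2 * i + 1)) :
    A.IsNode R (A.internalStep E R l i d) := by
  rw [A.internalStep_of_length E hd]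
  generalize hmove : internalMove _ _ = mv
  cases mv with
  | left =>
    refine ⟨rfl, rfl, by simp only [nextState]; omega, A.alive_of_childSize_pos ?_⟩
    refine Nat.pos_of_ne_zero fun h0 => ?_
    have := pos_of_internalMove_left hmove
    simp only [nextState] at h0
    rw [h0, List.take_zero, HierModel.gllr_nil] at this
    exact lt_irrefl _ this
  | right =>
    refine ⟨rfl, rfl, by simp only [nextState]; omega, A.alive_of_childSize_pos ?_⟩
    refine Nat.pos_of_ne_zero fun h0 => ?_
    have := pos_of_internalMove_right hmove
    simp only [nextState] at h0
    rw [List.drop_eq_nil_of_le (by omega), HierModel.gllr_nil] at this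
    exact lt_irrefl _ this
  | parent => exact A.isNode_toParent hl h

/-- A correct move decreases the distance from the closest target, and every move increases it by at
most one. -/
lemma targetDist_nextState {Y : Type*} {H R : Finset ℕ} (hH : H ⊆ Finset.range (2 ^ A.L))
    (hne : (H \ R).Nonempty) {l i : ℕ} (hl : l + 1 ≤ A.L) (h : A.Alive R (l + 1) i) {mv : HDSMove} :
    targetDist (H \ R) (A.nextState R l i mv : HDSState Y).level
        (A.nextState R l i mv : HDSState Y).index ≤ targetDist (H \ R) (l + 1) i + 1 ∧
      (mv.Correct ((H \ R).filter fun m => m / 2 ^ l = 2 * i).card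
          ((H \ R).filter fun m => m / 2 ^ l = 2 * i + 1).card →
        targetDist (H \ R) (A.nextState R l i mv : HDSState Y).level
          (A.nextState R l i mv : HDSState Y).index + 1 = targetDist (H \ R) (l + 1) i) := by
  set T := H \ R with hTdef
  have hT : T ⊆ Finset.range (2 ^ A.L) := Finset.sdiff_subset.trans hH
  have hchild : ∀ j, j / 2 = i → targetDist T l j ≤ targetDist T (l + 1) i + 1 ∧
      (HasTarget T l j → targetDist T l j + 1 = targetDist T (l + 1) i) := by
    intro j hj
    by_cases hc : HasTarget T l j
    · have h1 := targetDist_of_hasTarget hc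
      have h2 := targetDist_of_hasTarget (hj ▸ hc.parent)
      exact ⟨by omega, fun _ => by omega⟩
    · refine ⟨?_, fun h => absurd h hc⟩
      have hanc := A.hasTarget_ancestor hT hne hl h
      have : HasTarget T (l + (A.L - (l + 1) + 1)) (j / 2 ^ (A.L - (l + 1) + 1)) := by
        rw [pow_succ', ← Nat.div_div_eq_div_mul, hj]
        convert hanc using 1
        omega
      have h1 := targetDist_of_not_hasTarget this hc
      rw [hj] at h1
      exact h1.le
  cases mv with
  | left =>
    have := hchild (2 * i) (by omega)
    exact ⟨this.1, fun hc => this.2 (hasTarget_iff_card.2 hc)⟩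
  | right =>
    have := hchild (2 * i + 1) (by omega)
    exact ⟨this.1, fun hc => this.2 (hasTarget_iff_card.2 hc)⟩
  | parent =>
    simp only [nextState, toParent, HDSMove.Correct]
    split_ifs with hlt
    · by_cases hc : HasTarget T (l + 1) i
      · have h1 := targetDist_of_hasTarget hc
        have h2 := targetDist_of_hasTarget hc.parent
        refine ⟨by simp only; omega, fun hcorr => ?_⟩
        rcases hc.child with h3 | h3
        · have := hasTarget_iff_card.1 h3; omega
        · have := hasTarget_iff_card.1 h3; omega
      · have h1 := targetDist_of_not_hasTarget (A.hasTarget_ancestor hT hne hl h) hc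
        exact ⟨by simp only; omega, fun _ => by simp only; omega⟩
    -- At the root the walk stays, so the distance does not fall; but the root contains a target, so
    -- this move is never correct.
    · refine ⟨by simp only; omega, fun hcorr => ?_⟩
      have hroot : l + 1 = A.L := by omega
      have hc : HasTarget T (l + 1) i := by
        have := A.hasTarget_root hT hne (i := i) (by rw [← hroot]; exact h)
        rwa [← hroot] at this
      rcases hc.child with h3 | h3
      · have := hasTarget_iff_card.1 h3; omega
      · have := hasTarget_iff_card.1 h3; omega

/-! ### Gluing local potentials into a global one -/

/-- The distribution of the sample number `k` of an internal test on the node `(l + 1, i)`. -/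
noncomputable def sampleLaw (S : HierModel Θ Y) (param : Finset ℕ → ℕ → ℕ → Θ) (R : Finset ℕ)
    (l i k : ℕ) : Measure Y :=
  if k < A.childSize R l (2 * i) then S.law l (param R l (2 * i))
  else S.law l (param R l (2 * i + 1))

instance (param : Finset ℕ → ℕ → ℕ → Θ) (R : Finset ℕ) (l i k : ℕ) :
    SFinite (A.sampleLaw S param R l i k) := by
  unfold sampleLaw; split_ifs <;> infer_instance

/-- The value `x` is a bound for the expected number of samples after the state `s`, certified by a
potential of the current local test that is consistent with the bounds `U` at the nodes. -/
def Certified (param : Finset ℕ → ℕ → ℕ → Θ) (U : Finset ℕ → ℕ → ℕ → ℝ≥0∞) (s : HDSState Y)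
    (x : ℝ≥0∞) : Prop :=
  A.K ≤ s.removed.card ∨ (A.Alive s.removed s.level s.index ∧ s.level ≤ A.L ∧
    match s.level with
    -- B is the budget for the walks after a declaration, and v the additional one on arrival at the
    -- parent after a rejection.
    | 0 => ∃ (B v : ℝ≥0∞) (Ψ : List Y → ℝ≥0∞),
        HierModel.LeafPotential E A.N₀ (Real.log (A.L / A.c))
          (S.law 0 (param s.removed 0 s.index)) v Ψ ∧
        (s.data.length ≤ A.N₀ ∨ (0 ≤ HierModel.allr E A.N₀ s.data ∧
          HierModel.allr E A.N₀ s.data ≤ Real.log (A.L / A.c))) ∧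
        B + Ψ s.data ≤ x ∧ U s.removed 1 (s.index / 2) ≤ B + v ∧
        (A.K ≤ s.removed.card + 1 ∨ U (insert s.index s.removed) A.L 0 ≤ B)
    -- The test has n ≥ 1 samples left, and F dominates the value at the next node. The potential is
    -- n plus the conditional mean of F.
    | l + 1 => ∃ (n : ℕ) (F : List Y → ℝ≥0∞),
        s.data.length + n =
          A.childSize s.removed l (2 * s.index) + A.childSize s.removed l (2 * s.index + 1) ∧
        0 < n ∧ ListMeasurable F ∧
        (∀ d : List Y, d.length =
            A.childSize s.removed l (2 * s.index) + A.childSize s.removed l (2 * s.index + 1) →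
          U s.removed (A.internalStep E s.removed l s.index d).level
            (A.internalStep E s.removed l s.index d).index ≤ F d) ∧
        n + iteratedMean (A.sampleLaw S param s.removed l s.index) F n s.data ≤ x)

/-- Consistent bounds at the nodes decrease by one per sample on average. -/
lemma certified_step (hL : 1 ≤ A.L) (hKL : A.K ≤ 2 ^ A.L) {param : Finset ℕ → ℕ → ℕ → Θ}
    {U : Finset ℕ → ℕ → ℕ → ℝ≥0∞}
    (hU : ∀ R l i, R.card < A.K → l ≤ A.L → A.Alive R l i →
      A.Certified E param U ⟨R, l, i, []⟩ (U R l i))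
    (s : HDSState Y) (x : ℝ≥0∞) (hs : A.Certified E param U s x) :
    A.K ≤ s.removed.card ∨
      ∃ g : Y → ℝ≥0∞, Measurable g ∧
        1 + ∫⁻ y, g y ∂(S.law (A.query s).1 (param s.removed (A.query s).1 (A.query s).2)) ≤ x ∧
        ∀ᵐ y ∂(S.law (A.query s).1 (param s.removed (A.query s).1 (A.query s).2)),
          ∃ x' ≤ g y, A.Certified E param U (A.update E s y) x' := by
  rcases lt_or_ge s.removed.card A.K with hK | hK
  swap
  · exact Or.inl hK
  rcases hs with hs | ⟨halive, hle, hs⟩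
  · exact Or.inl hs
  right
  have hnode : ∀ t : HDSState Y, A.IsNode s.removed t →
      A.Certified E param U t (U s.removed t.level t.index) := by
    rintro ⟨R, l, i, d⟩ ⟨rfl, rfl, h1, h2⟩
    exact hU s.removed l i hK h1 h2
  obtain ⟨R, l, i, d⟩ := s
  simp only at halive hle hs hnode hK
  cases l with
  | zero =>
    obtain ⟨B, v, Ψ, hΨ, hcont, hx, hparent, hacc⟩ := hs
    obtain ⟨g, hgm, hg, hgy⟩ := hΨ d hcont
    refine ⟨fun y => B + g y, hgm.const_add B, ?_, ?_⟩
    · refine le_trans ?_ hx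
      change 1 + ∫⁻ y, (B + g y) ∂(S.law 0 (param R 0 i)) ≤ _
      rw [lintegral_add_left measurable_const, lintegral_const, measure_univ, mul_one,
        add_left_comm]
      gcongr
    · change ∀ᵐ y ∂(S.law 0 (param R 0 i)), _
      filter_upwards [hgy] with y hy
      change ∃ x' ≤ B + g y, A.Certified E param U (A.leafStep E R i (d ++ [y])) x'
      unfold HierModel.leafCost at hy
      unfold leafStep
      split_ifs at hy ⊢ with h1 h2 h3
      · exact ⟨B + Ψ (d ++ [y]), by gcongr,
          Or.inr ⟨halive, hle, B, v, Ψ, hΨ, Or.inl h1, le_rfl, hparent, hacc⟩⟩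
      · have hcard : (insert i R).card = R.card + 1 := by
          obtain ⟨m, _, hm, hmi⟩ := halive
          have : m = i := by simpa using hmi
          exact Finset.card_insert_of_notMem (this ▸ hm)
        rcases lt_or_ge (R.card + 1) A.K with hlt | hge
        · rcases hacc with h | h
          · omega
          · exact ⟨_, h.trans le_self_add, hU (insert i R) A.L 0 (by omega) le_rfl
              (A.alive_root (by omega))⟩
        · exact ⟨0, zero_le, Or.inl (by simp only [start]; omega)⟩
      · refine ⟨_, ?_, hnode _ (A.isNode_toParent hle halive)⟩
        have : (A.toParent R 0 i : HDSState Y) = ⟨R, 1, i / 2, []⟩ := if_pos hL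
        rw [this]
        exact hparent.trans (by gcongr)
      · exact ⟨B + Ψ (d ++ [y]), by gcongr, Or.inr ⟨halive, hle, B, v, Ψ, hΨ,
          Or.inr ⟨not_lt.1 h3, not_lt.1 h2⟩, le_rfl, hparent, hacc⟩⟩
  | succ l =>
    obtain ⟨n, F, hn, hn0, hF, hFU, hx⟩ := hs
    obtain ⟨n, rfl⟩ : ∃ k, n = k + 1 := ⟨n - 1, by omega⟩
    have hlaw : S.law (A.query (⟨R, l + 1, i, d⟩ : HDSState Y)).1
        (param R (A.query (⟨R, l + 1, i, d⟩ : HDSState Y)).1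
          (A.query (⟨R, l + 1, i, d⟩ : HDSState Y)).2) = A.sampleLaw S param R l i d.length := by
      simp only [query, sampleLaw]
      split_ifs <;> rfl
    suffices h : ∃ g : Y → ℝ≥0∞, Measurable g ∧
        1 + ∫⁻ y, g y ∂(A.sampleLaw S param R l i d.length) ≤ x ∧
        ∀ᵐ y ∂(A.sampleLaw S param R l i d.length),
          ∃ x' ≤ g y, A.Certified E param U (A.update E ⟨R, l + 1, i, d⟩ y) x' by
      rw [← hlaw] at h
      exact h
    have hmean := hF.iteratedMean (μ := A.sampleLaw S param R l i) n
    refine ⟨fun y => n + iteratedMean (A.sampleLaw S param R l i) F n (d ++ [y]),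
      (hmean.const_append_singleton d).const_add _, ?_, Filter.Eventually.of_forall fun y => ?_⟩
    · refine le_trans (le_of_eq ?_) hx
      have hprob : IsProbabilityMeasure (A.sampleLaw S param R l i d.length) := by
        unfold sampleLaw; split_ifs <;> infer_instance
      rw [lintegral_add_left measurable_const, lintegral_const, measure_univ, mul_one,
        iteratedMean]
      push_cast
      rw [add_comm (n : ℝ≥0∞) 1, add_assoc]
    · change ∃ x' ≤ _, A.Certified E param U (A.internalStep E R l i (d ++ [y])) x'
      have hlen : (d ++ [y]).length = d.length + 1 := by simp
      rcases Nat.eq_zero_or_pos n with rfl | hn'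
      · have hlen' : (d ++ [y]).length =
            A.childSize R l (2 * i) + A.childSize R l (2 * i + 1) := by omega
        refine ⟨_, ?_, hnode _ (A.isNode_internalStep E hle halive hlen')⟩
        exact (hFU _ hlen').trans (by simp [iteratedMean])
      · rw [internalStep, if_pos (by omega)]
        exact ⟨_, le_rfl, Or.inr ⟨halive, hle, n, F, by simp only; omega, hn', hF, hFU, le_rfl⟩⟩

end HDSParams

/-- The sample sizes occur in types; variables with equations let `childSize` be inserted without
rewriting these types. -/
lemma HierModel.ReliableTest.le_measure {Θ Y : Type*} [MeasurableSpace Y] {S : HierModel Θ Y}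
    {E : S.MLE} {K l n : ℕ} {p : ℝ} (h : HierModel.ReliableTest E K l n p) {aL aR : Bool}
    {jL jR : ℕ} {φL φR : Θ} (ha : aL = true ∨ aR = true) (haL : aL = false → jL = 0)
    (haR : aR = false → jR = 0) (hjL : jL ≤ 2 ^ l) (hjR : jR ≤ 2 ^ l) (hK : jL + jR ≤ K)
    (hφL : φL ∈ S.paramSet l jL) (hφR : φR ∈ S.paramSet l jR) {nL nR : ℕ}
    (hnL : nL = if aL then n else 0) (hnR : nR = if aR then n else 0) :
    ENNReal.ofReal p ≤
      ((Measure.pi (fun _ : Fin nL => S.law l φL)).prod (Measure.pi (fun _ : Fin nR => S.law l φR)))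
        {x | (internalMove (HierModel.gllr E l (List.ofFn x.1))
          (HierModel.gllr E l (List.ofFn x.2))).Correct jL jR} := by
  subst hnL hnR
  exact h aL aR jL jR φL φR ha haL haR hjL hjR hK hφL hφR

lemma card_filter_div_two_pow_le (T : Finset ℕ) (l i : ℕ) :
    (T.filter fun m => m / 2 ^ l = i).card ≤ 2 ^ l := by
  have : (T.filter fun m => m / 2 ^ l = i) ⊆ Finset.Ico (2 ^ l * i) (2 ^ l * (i + 1)) := by
    intro m hm
    have h := (Finset.mem_filter.1 hm).2
    have hpos : 0 < 2 ^ l := by positivity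
    rw [Finset.mem_Ico]
    constructor
    · rw [← h]; exact Nat.mul_div_le m _
    · rw [← h]; exact Nat.lt_mul_div_succ m hpos
  refine (Finset.card_le_card this).trans ?_
  rw [Nat.card_Ico, ← Nat.mul_sub, Nat.add_sub_cancel_left, mul_one]

/-! ### Bounds at the nodes -/

namespace HDSParams

variable {Θ Y : Type*} [MeasurableSpace Y] {S : HierModel Θ Y} (A : HDSParams) (E : S.MLE)

/-- A bound for the expected number of samples after the arrival at a node, if a walk from the
closest target costs `α` and every level of the tree costs `a`. -/
noncomputable def nodeBound (H : Finset ℕ) (α a : ℝ) (R : Finset ℕ) (l i : ℕ) : ℝ≥0∞ :=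
  ENNReal.ofReal (((A.K : ℝ) - R.card - 1) * (α + a * A.L) + (α + a * targetDist (H \ R) l i))

section nodeBound

variable {H R : Finset ℕ} {α a : ℝ}

/-- Pigeonhole: even if some declarations were false, fewer than K removals leave a target, so
distances are meaningful. -/
lemma sdiff_nonempty_of_card_lt (hHK : H.card = A.K) (hR : R.card < A.K) : (H \ R).Nonempty := by
  rw [← Finset.card_pos]
  have := Finset.le_card_sdiff R H
  omega

lemma remaining_nonneg (hR : R.card < A.K) : (0 : ℝ) ≤ (A.K : ℝ) - R.card - 1 := by
  have : (R.card : ℝ) + 1 ≤ A.K := by exact_mod_cast hR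
  linarith

lemma nodeBound_root (hH : H ⊆ Finset.range (2 ^ A.L)) (hHK : H.card = A.K) (hR : R.card < A.K)
    (hKL : A.K ≤ 2 ^ A.L) :
    A.nodeBound H α a R A.L 0 = ENNReal.ofReal (((A.K : ℝ) - R.card) * (α + a * A.L)) := by
  have hT := Finset.sdiff_subset (t := R).trans hH
  rw [nodeBound, targetDist_of_hasTarget (A.hasTarget_root hT
    (A.sdiff_nonempty_of_card_lt hHK hR) (A.alive_root (R := R) (by omega)))]
  congr 1
  ring

/-- The new root is at distance exactly L from a remaining target. Whether the declared leaf was a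
target plays no role. -/
lemma nodeBound_insert_le (hH : H ⊆ Finset.range (2 ^ A.L)) (hHK : H.card = A.K)
    (hKL : A.K ≤ 2 ^ A.L) {i : ℕ} (hi : i ∉ R) :
    A.K ≤ R.card + 1 ∨ A.nodeBound H α a (insert i R) A.L 0 ≤
      ENNReal.ofReal (((A.K : ℝ) - R.card - 1) * (α + a * A.L)) := by
  rcases le_or_gt A.K (R.card + 1) with h | h
  · exact Or.inl h
  · right
    have hc : (insert i R).card = R.card + 1 := Finset.card_insert_of_notMem hi
    rw [A.nodeBound_root hH hHK (by omega) hKL, hc]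
    push_cast
    exact ENNReal.ofReal_le_ofReal (le_of_eq (by ring))

lemma nodeBound_eq_add (hR : R.card < A.K) (hα : 0 ≤ α) (ha : 0 ≤ a) (l i : ℕ) :
    A.nodeBound H α a R l i =
      ENNReal.ofReal (((A.K : ℝ) - R.card - 1) * (α + a * A.L)) +
        ENNReal.ofReal (α + a * targetDist (H \ R) l i) :=
  ENNReal.ofReal_add (mul_nonneg (A.remaining_nonneg hR) (by positivity)) (by positivity)

variable {param : Finset ℕ → ℕ → ℕ → Θ}

/-- The bound at a leaf follows from a potential of its test. -/
lemma certified_leaf (hH : H ⊆ Finset.range (2 ^ A.L)) (hHK : H.card = A.K)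
    (hKL : A.K ≤ 2 ^ A.L) (hα : 0 ≤ α) (ha : 0 ≤ a) {i : ℕ} (hR : R.card < A.K)
    (halive : A.Alive R 0 i) {v : ℝ≥0∞} {Ψ : List Y → ℝ≥0∞}
    (hΨ : HierModel.LeafPotential E A.N₀ (Real.log (A.L / A.c)) (S.law 0 (param R 0 i)) v Ψ)
    (hstart : Ψ [] ≤ ENNReal.ofReal (α + a * targetDist (H \ R) 0 i))
    (hparent : ENNReal.ofReal (α + a * targetDist (H \ R) 1 (i / 2)) ≤ v) :
    A.Certified E param (A.nodeBound H α a) ⟨R, 0, i, []⟩ (A.nodeBound H α a R 0 i) := by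
  have hi : i ∉ R := by
    obtain ⟨m, _, hm, hmi⟩ := halive
    have : m = i := by simpa using hmi
    exact this ▸ hm
  refine Or.inr ⟨halive, Nat.zero_le _,
    ENNReal.ofReal (((A.K : ℝ) - R.card - 1) * (α + a * A.L)), v, Ψ, hΨ, Or.inl (by simp), ?_, ?_,
    A.nodeBound_insert_le hH hHK hKL hi⟩
  · rw [A.nodeBound_eq_add hR hα ha]
    gcongr
  · rw [A.nodeBound_eq_add hR hα ha]
    gcongr

/-- The bound at an internal node follows from the reliability of the internal test. -/
lemma certified_internal (hH : H ⊆ Finset.range (2 ^ A.L)) (hHK : H.card = A.K)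
    (hα : 0 ≤ α) (ha : 0 ≤ a) {l i : ℕ} (hR : R.card < A.K) (hl : l + 1 ≤ A.L)
    (halive : A.Alive R (l + 1) i) (hfin : (S.anom l 1).Finite) (hadm : A.Admissible S H param)
    {p : ℝ} {Nmax : ℕ} (hN1 : 1 ≤ A.N l) (hNmax : A.N l ≤ Nmax)
    (hrel : HierModel.ReliableTest E A.K l (A.N l) p) (hap : 2 * Nmax ≤ a * (2 * p - 1)) :
    A.Certified E param (A.nodeBound H α a) ⟨R, l + 1, i, []⟩ (A.nodeBound H α a R (l + 1) i) := by
  classical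
  set T := H \ R with hT
  have hne : T.Nonempty := A.sdiff_nonempty_of_card_lt hHK hR
  set jL := (T.filter fun m => m / 2 ^ l = 2 * i).card with hjL
  set jR := (T.filter fun m => m / 2 ^ l = 2 * i + 1).card with hjR
  set nL := A.childSize R l (2 * i) with hnL
  set nR := A.childSize R l (2 * i + 1) with hnR
  set δ := targetDist T (l + 1) i with hδ
  have hδ1 : 1 ≤ δ := by rw [hδ, targetDist]; omega
  have hδ1' : (1 : ℝ) ≤ δ := by exact_mod_cast hδ1
  set base := ((A.K : ℝ) - R.card - 1) * (α + a * A.L) with hbase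
  have hbase0 : 0 ≤ base := mul_nonneg (A.remaining_nonneg hR) (by positivity)
  have hq0 : 0 ≤ base + (α + a * ((δ : ℝ) - 1)) := by
    have : 0 ≤ (δ : ℝ) - 1 := by linarith
    positivity
  -- The value after a correct move. A wrong move ends at most two levels farther away, hence the
  -- penalty 2a in F.
  set q := base + (α + a * ((δ : ℝ) - 1)) with hq
  set bad : Set (List Y) := {d | ¬ (internalMove (HierModel.gllr E l (d.take nL))
    (HierModel.gllr E l (d.drop nL))).Correct jL jR} with hbad
  set F : List Y → ℝ≥0∞ := fun d =>
    ENNReal.ofReal q + bad.indicator (fun _ => ENNReal.ofReal (2 * a)) d with hF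
  have hg := HierModel.listMeasurable_gllr E hfin
  have hFm : ListMeasurable F := fun n =>
    ((measurable_const (a := ENNReal.ofReal (2 * a))).indicator (measurableSet_internalMove_correct
      (hg.take nL n) (hg.drop nL n) jL jR).compl).const_add _
  have hsizeL : nL = if decide (A.Alive R l (2 * i)) = true then A.N l else 0 := by
    simp [hnL, childSize]
  have hsizeR : nR = if decide (A.Alive R l (2 * i + 1)) = true then A.N l else 0 := by
    simp [hnR, childSize]
  have hchild := A.alive_child halive
  have hpos : 0 < nL + nR := by
    rcases hchild with h | h
    · rw [hsizeL, if_pos (by simpa using h)]; omega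
    · rw [hsizeR, if_pos (by simpa using h)]; omega
  have hle : nL + nR ≤ 2 * Nmax := by
    have h1 : nL ≤ A.N l := by rw [hsizeL]; split_ifs <;> omega
    have h2 : nR ≤ A.N l := by rw [hsizeR]; split_ifs <;> omega
    omega
  refine Or.inr ⟨halive, hl, nL + nR, F, by simp [hnL, hnR], hpos, hFm, fun d hd => ?_, ?_⟩
  · have hmove := A.targetDist_nextState (Y := Y) hH hne hl halive
      (mv := internalMove (HierModel.gllr E l (d.take nL)) (HierModel.gllr E l (d.drop nL)))
    change A.nodeBound H α a R (A.internalStep E R l i d).level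
      (A.internalStep E R l i d).index ≤ F d
    rw [A.internalStep_of_length E hd]
    set t : HDSState Y := A.nextState R l i
      (internalMove (HierModel.gllr E l (d.take nL)) (HierModel.gllr E l (d.drop nL)))
    by_cases hc : d ∈ bad
    · have h1 : (targetDist T t.level t.index : ℝ) ≤ δ + 1 := by exact_mod_cast hmove.1
      simp only [hF, Set.indicator_of_mem hc]
      rw [← ENNReal.ofReal_add hq0 (by positivity)]
      refine ENNReal.ofReal_le_ofReal ?_
      have := mul_le_mul_of_nonneg_left h1 ha
      rw [hq]
      linarith
    · have h1 : (targetDist T t.level t.index : ℝ) + 1 = δ := by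
        exact_mod_cast hmove.2 (not_not.1 hc)
      simp only [hF, Set.indicator_of_notMem hc, add_zero]
      refine ENNReal.ofReal_le_ofReal ?_
      rw [hq, ← h1]
      linarith
  · set φL := param R l (2 * i)
    set φR := param R l (2 * i + 1)
    set P := (Measure.pi (fun _ : Fin nL => S.law l φL)).prod
      (Measure.pi (fun _ : Fin nR => S.law l φR)) with hP
    set G : Set ((Fin nL → Y) × (Fin nR → Y)) :=
      {x | (internalMove (HierModel.gllr E l (List.ofFn x.1))
        (HierModel.gllr E l (List.ofFn x.2))).Correct jL jR} with hG
    have hGm : MeasurableSet G := measurableSet_internalMove_correct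
      ((hg nL).comp measurable_fst) ((hg nR).comp measurable_snd) jL jR
    have hjT : jL + jR ≤ A.K := by
      rw [hjL, hjR, ← Finset.card_union_of_disjoint]
      · rw [← hHK]
        exact Finset.card_le_card (Finset.union_subset
          ((Finset.filter_subset _ _).trans Finset.sdiff_subset)
          ((Finset.filter_subset _ _).trans Finset.sdiff_subset))
      · rw [Finset.disjoint_filter]
        omega
    have hdead : ∀ j, decide (A.Alive R l j) = false →
        (T.filter fun m => m / 2 ^ l = j).card = 0 := fun j hj => by
      by_contra h
      exact (of_decide_eq_false hj)
        (A.alive_of_hasTarget hH (hasTarget_iff_card.2 (Nat.pos_of_ne_zero h)))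
    have hprob : ENNReal.ofReal p ≤ P G := hrel.le_measure
      (by simpa using hchild) (hdead _) (hdead _) (card_filter_div_two_pow_le T l _)
      (card_filter_div_two_pow_le T l _) hjT (hadm R l _ hl) (hadm R l _ hl) hsizeL hsizeR
    have hmean : iteratedMean (A.sampleLaw S param R l i) F (nL + nR) [] =
        ENNReal.ofReal q + ENNReal.ofReal (2 * a) * P Gᶜ := by
      refine (iteratedMean_two_samples hFm (S.law l φL) (S.law l φR) nL nR).trans ?_
      have h1 : ∀ x : (Fin nL → Y) × (Fin nR → Y), F (List.ofFn x.1 ++ List.ofFn x.2) =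
          ENNReal.ofReal q + Gᶜ.indicator (fun _ => ENNReal.ofReal (2 * a)) x := fun x => by
        have h2 : List.ofFn x.1 ++ List.ofFn x.2 ∈ bad ↔ x ∈ Gᶜ := by
          have e1 : (List.ofFn x.1 ++ List.ofFn x.2).take nL = List.ofFn x.1 :=
            List.take_left' (by simp)
          have e2 : (List.ofFn x.1 ++ List.ofFn x.2).drop nL = List.ofFn x.2 :=
            List.drop_left' (by simp)
          change ¬ _ ↔ ¬ _
          rw [e1, e2]
          exact Iff.rfl
        by_cases hx : x ∈ Gᶜ
        · simp only [hF, Set.indicator_of_mem (h2.2 hx), Set.indicator_of_mem hx]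
        · simp only [hF, Set.indicator_of_notMem (fun h => hx (h2.1 h)),
            Set.indicator_of_notMem hx]
      simp only [h1]
      rw [lintegral_add_left measurable_const, lintegral_const, measure_univ, mul_one,
        lintegral_indicator_const hGm.compl]
    have hpr : p ≤ (P G).toReal := (ENNReal.ofReal_le_iff_le_toReal (measure_ne_top _ _)).1 hprob
    have hcompl : P Gᶜ = ENNReal.ofReal (1 - (P G).toReal) := by
      rw [prob_compl_eq_one_sub hGm, ENNReal.ofReal_sub _ ENNReal.toReal_nonneg,
        ENNReal.ofReal_one, ENNReal.ofReal_toReal (measure_ne_top _ _)]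
    have hpr1 : (P G).toReal ≤ 1 := ENNReal.toReal_le_of_le_ofReal zero_le_one
      (by simpa using prob_le_one)
    change ((nL + nR : ℕ) : ℝ≥0∞) + iteratedMean (A.sampleLaw S param R l i) F (nL + nR) [] ≤ _
    rw [hmean, hcompl, ← ENNReal.ofReal_mul (by positivity), ← ENNReal.ofReal_natCast,
      ← ENNReal.ofReal_add hq0 (mul_nonneg (by positivity) (by linarith)),
      ← ENNReal.ofReal_add (by positivity)
        (add_nonneg hq0 (mul_nonneg (by positivity) (by linarith)))]
    -- The claim reduces to nL + nR ≤ a - 2a·P(wrong), where the right-hand side is at least a(2p -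
    -- 1) ≥ 2·Nmax.
    refine ENNReal.ofReal_le_ofReal ?_
    have h1 : ((nL + nR : ℕ) : ℝ) ≤ 2 * Nmax := by exact_mod_cast hle
    have h2 : a * p ≤ a * (P G).toReal := mul_le_mul_of_nonneg_left hpr ha
    rw [hq]
    linarith

end nodeBound

/-- Consistent bounds at the nodes bound the expected number of samples. -/
theorem lintegral_stopTime_le_nodeBound (hL : 1 ≤ A.L) (hK : 1 ≤ A.K) (hKL : A.K ≤ 2 ^ A.L)
    {H : Finset ℕ} (hH : H ∈ A.hypotheses) {α a : ℝ} {param : Finset ℕ → ℕ → ℕ → Θ}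
    (hU : ∀ R l i, R.card < A.K → l ≤ A.L → A.Alive R l i →
      A.Certified E param (A.nodeBound H α a) ⟨R, l, i, []⟩ (A.nodeBound H α a R l i)) :
    ∫⁻ ω, A.stopTime E ω ∂(obsLaw S param) ≤ ENNReal.ofReal (A.K * (α + a * A.L)) := by
  obtain ⟨hsub, hcard⟩ := Finset.mem_powersetCard.1 hH
  have h0 : (∅ : Finset ℕ).card < A.K := by rwa [Finset.card_empty]
  refine A.lintegral_stopTime_le E fun n => ?_
  have := A.lintegral_truncTime_le E (A.Certified E param (A.nodeBound H α a))
    (A.certified_step E hL hKL hU) n _ _ (hU ∅ A.L 0 h0 le_rfl (A.alive_root (by omega)))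
  rwa [A.nodeBound_root hsub hcard h0 hKL, Finset.card_empty, Nat.cast_zero, sub_zero] at this

lemma param_leaf {H : Finset ℕ} {param : Finset ℕ → ℕ → ℕ → Θ} (hadm : A.Admissible S H param)
    (hL : 1 ≤ A.L) (R : Finset ℕ) (i : ℕ) :
    (i ∈ H \ R → param R 0 i ∈ S.anom 0 1) ∧ (i ∉ H \ R → param R 0 i = S.null 0) := by
  have h := hadm R 0 i hL
  simp only [pow_zero, Nat.div_one] at h
  rw [Finset.filter_eq'] at h
  constructor <;> intro hi
  · rw [if_pos hi] at h
    simpa [HierModel.paramSet] using h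
  · rw [if_neg hi] at h
    simpa [HierModel.paramSet] using h

end HDSParams

/-! ### The constants and the final bound -/

/-- The bound on the sample complexity of the search. -/
theorem exists_sampleComplexity_bound {Θ Y : Type*} [MeasurableSpace Y] {S : HierModel Θ Y}
    (E : S.MLE) {Δ : ℝ≥0} (hΔ : 0 < Δ) (hdist : S.Distinguishable Δ)
    (hfin : ∀ l, (S.anom l 1).Finite) {V : ℝ≥0} (hmom : S.MomentBound V 1 0) :
    ∃ N₀min : ℕ, ∀ N₀, N₀min ≤ N₀ → ∀ (p : ℝ) (Nmax : ℕ), 1 / 2 < p →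
      ∃ C : ℝ, ∀ A : HDSParams, A.N₀ = N₀ → 1 ≤ A.L → 1 ≤ A.K → A.K ≤ 2 ^ A.L →
        0 < A.c → A.c < 1 →
        (∀ l, l < A.L → 1 ≤ A.N l ∧ A.N l ≤ Nmax ∧
          HierModel.ReliableTest E A.K l (A.N l) p) →
        ∀ (prior : Finset ℕ → ℝ≥0∞) (param : Finset ℕ → Finset ℕ → ℕ → ℕ → Θ) (θ₁ : Θ),
          ∑ H ∈ A.hypotheses, prior H = 1 →
          (∀ H ∈ A.hypotheses, A.Admissible S H (param H)) →
          θ₁ ∈ S.anom 0 1 →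
          (∀ H ∈ A.hypotheses, ∀ R, ∀ m ∈ H \ R,
            S.kl 0 θ₁ (S.null 0) ≤ S.kl 0 (param H R 0 m) (S.null 0)) →
          A.sampleComplexity E prior param ≤
            ENNReal.ofReal ((A.K : ℝ) * C * A.L
              + (A.K : ℝ) * Real.log ((A.L : ℝ) / A.c) / (S.kl 0 θ₁ (S.null 0)).toReal) := by
  classical
  have hΔ' : (0 : ℝ) < Δ := by exact_mod_cast hΔ
  have hV0 : (0 : ℝ) ≤ V := V.2
  obtain ⟨_, hnullsq⟩ := hmom.2 0 (Nat.zero_le _) (S.null 0) (by simp [HierModel.paramSet])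
  have hanom : ∀ θ ∈ S.anom 0 1, S.kl 0 θ (S.null 0) ≠ ∞ ∧ ∀ θ' ∈ S.anom 0 1,
      ∫⁻ y, ENNReal.ofReal (S.logRatio 0 θ' y ^ 2) ∂(S.law 0 θ) ≤ (V : ℝ≥0∞) := fun θ hθ =>
    hmom.2 1 (by simp) θ (by simpa [HierModel.paramSet] using hθ)
  have hle_kl : ∀ θ ∈ S.anom 0 1, (Δ : ℝ) ≤ (S.kl 0 θ (S.null 0)).toReal := fun θ hθ =>
    (ENNReal.ofReal_le_iff_le_toReal (hanom θ hθ).1).1 (by simpa using (hdist 0 θ hθ).2)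
  have hmean : ∀ θ ∈ S.anom 0 1,
      ∫ y, S.logRatio 0 θ y ∂(S.law 0 θ) = (S.kl 0 θ (S.null 0)).toReal := fun θ hθ => by
    have hself : S.kl 0 θ θ = 0 := by rw [HierModel.kl, klDiv_self]
    rw [S.integral_logRatio (hanom θ hθ).1 (by simp [hself]), hself]
    simp
  have hnullmean : ∀ θ ∈ S.anom 0 1,
      ∫ y, S.logRatio 0 θ y ∂(S.law 0 (S.null 0)) ≤ -Δ := fun θ hθ => by
    rw [S.integral_logRatio_null (hmom.1 θ hθ), neg_le_neg_iff]
    exact (ENNReal.ofReal_le_iff_le_toReal (hmom.1 θ hθ)).1 (by simpa using (hdist 0 θ hθ).1)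
  have hexN : ∀ θ, ∃ N₁ : ℕ, θ ∈ S.anom 0 1 → ∀ N₀, N₁ ≤ N₀ → ∀ a : ℝ, 0 ≤ a → ∃ A₀ : ℝ,
      ∀ A, A₀ ≤ A → 0 ≤ A → ∀ D b : ℝ, Δ ≤ D → D ≤ (S.kl 0 θ (S.null 0)).toReal → 0 ≤ b →
      ∃ Ψ : List Y → ℝ≥0∞, Ψ [] ≤ ENNReal.ofReal (b / D + A) ∧
        HierModel.LeafPotential E N₀ b (S.law 0 θ) (ENNReal.ofReal (b / D + A + a)) Ψ := by
    intro θ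
    by_cases hθ : θ ∈ S.anom 0 1
    · obtain ⟨N₁, h⟩ := HierModel.exists_leafPotential_target E (hfin 0) hθ (V := V) hΔ'
        (S.kl_ne_top_imp (hanom θ hθ).1).1
        (fun θ' h' => S.memLp_logRatio ((hanom θ hθ).2 θ' h'))
        (fun θ' h' => S.integral_sq_logRatio_le ((hanom θ hθ).2 θ' h'))
        (by rw [hmean θ hθ]; exact hle_kl θ hθ)
      rw [hmean θ hθ] at h
      exact ⟨N₁, fun _ => h⟩
    · exact ⟨0, fun h => absurd h hθ⟩
  choose N₁ hN₁ using hexN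
  refine ⟨(hfin 0).toFinset.sup N₁, fun N₀ hN₀ p Nmax hp => ?_⟩
  have hp' : 0 < 2 * p - 1 := by linarith
  -- The first summand pays for an internal test, the second for the test of a normal leaf, whose
  -- rejection brings the walk one level closer.
  set a : ℝ := 2 * Nmax / (2 * p - 1) + (N₀ + V / (Δ : ℝ) ^ 2 + 1) with ha
  have ha0 : 0 ≤ a := by positivity
  have hap : 2 * Nmax ≤ a * (2 * p - 1) := by
    have h1 : 2 * Nmax / (2 * p - 1) * (2 * p - 1) = 2 * Nmax := by field_simp
    have h2 : 0 ≤ (N₀ + V / (Δ : ℝ) ^ 2 + 1) * (2 * p - 1) := by positivity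
    rw [ha, add_mul]
    linarith
  have hexA : ∀ θ, ∃ A₀ : ℝ, θ ∈ S.anom 0 1 →
      ∀ A, A₀ ≤ A → 0 ≤ A → ∀ D b : ℝ, Δ ≤ D → D ≤ (S.kl 0 θ (S.null 0)).toReal → 0 ≤ b →
      ∃ Ψ : List Y → ℝ≥0∞, Ψ [] ≤ ENNReal.ofReal (b / D + A) ∧
        HierModel.LeafPotential E N₀ b (S.law 0 θ) (ENNReal.ofReal (b / D + A + a)) Ψ := by
    intro θ
    by_cases hθ : θ ∈ S.anom 0 1
    · obtain ⟨A₀, h⟩ := hN₁ θ hθ N₀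
        ((Finset.le_sup ((hfin 0).mem_toFinset.2 hθ)).trans hN₀) a ha0
      exact ⟨A₀, fun _ => h⟩
    · exact ⟨0, fun h => absurd h hθ⟩
  choose A₀ hA₀ using hexA
  -- A common upper bound of the finitely many thresholds, nonnegative by construction.
  set A' : ℝ := ∑ θ ∈ (hfin 0).toFinset, |A₀ θ| with hA'
  have hA'0 : 0 ≤ A' := Finset.sum_nonneg fun _ _ => abs_nonneg _
  have hA₀A' : ∀ θ ∈ S.anom 0 1, A₀ θ ≤ A' := fun θ hθ => (le_abs_self _).trans
    (Finset.single_le_sum (f := fun θ => |A₀ θ|) (fun _ _ => abs_nonneg _)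
      ((hfin 0).mem_toFinset.2 hθ))
  -- Since L ≥ 1, the constant A' per target is absorbed by the term proportional to L.
  refine ⟨A' + a, fun A hAN hL hK hKL hc0 hc1 hN prior param θ₁ hprior hadm hθ₁ hmin => ?_⟩
  have hL' : (1 : ℝ) ≤ A.L := by exact_mod_cast hL
  set b := Real.log ((A.L : ℝ) / A.c) with hb
  have hb0 : 0 ≤ b := Real.log_nonneg (by rw [le_div_iff₀ hc0]; linarith)
  set D := (S.kl 0 θ₁ (S.null 0)).toReal with hD
  have hΔD : (Δ : ℝ) ≤ D := hle_kl θ₁ hθ₁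
  have hD0 : 0 < D := hΔ'.trans_le hΔD
  have hα0 : 0 ≤ b / D + A' := by positivity
  have hbound : ∀ H ∈ A.hypotheses, ∫⁻ ω, A.stopTime E ω ∂(HDSParams.obsLaw S (param H)) ≤
      ENNReal.ofReal (A.K * (b / D + A' + a * A.L)) := by
    intro H hH
    obtain ⟨hsub, hcard⟩ := Finset.mem_powersetCard.1 hH
    refine A.lintegral_stopTime_le_nodeBound E hL hK hKL hH fun R l i hR hl halive => ?_
    cases l with
    | succ l =>
      obtain ⟨h1, h2, h3⟩ := hN l hl
      exact A.certified_internal E hsub hcard hα0 ha0 hR hl halive (hfin l) (hadm H hH)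
        h1 h2 h3 hap
    | zero =>
      obtain ⟨hin, hout⟩ := A.param_leaf (hadm H hH) hL R i
      by_cases hi : i ∈ H \ R
      · have hθ := hin hi
        -- One D serves for all targets, because the drift of each is at least the smallest
        -- divergence.
        obtain ⟨Ψ, hstart, hΨ⟩ := hA₀ _ hθ A' (hA₀A' _ hθ) hA'0 D b hΔD
          (ENNReal.toReal_mono (hanom _ hθ).1 (hmin H hH R i hi)) hb0
        have hhas : HasTarget (H \ R) 0 i := ⟨i, hi, by simp⟩
        rw [← hAN] at hΨ
        refine A.certified_leaf E hsub hcard hKL hα0 ha0 hR halive hΨ ?_ ?_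
        · simpa [targetDist_of_hasTarget hhas] using hstart
        · rw [targetDist_of_hasTarget hhas.parent]
          simp
      · have hhas : ¬ HasTarget (H \ R) 0 i := by
          rintro ⟨m, hm, hmi⟩
          have : m = i := by simpa using hmi
          exact hi (this ▸ hm)
        have hdist1 := targetDist_of_not_hasTarget (A.hasTarget_ancestor
          (Finset.sdiff_subset.trans hsub) (A.sdiff_nonempty_of_card_lt hcard hR) hl halive) hhas
        obtain ⟨Ψ, hstart, hΨ⟩ := HierModel.exists_leafPotential_null E hΔ' hV0
          (fun θ hθ => S.memLp_logRatio (hnullsq θ hθ))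
          (fun θ hθ => S.integral_sq_logRatio_le (hnullsq θ hθ)) hnullmean N₀ b
          (b / D + A' + a * targetDist (H \ R) 1 (i / 2)) (by positivity)
        rw [← hout hi, ← hAN] at hΨ
        refine A.certified_leaf E hsub hcard hKL hα0 ha0 hR halive hΨ
          (hstart.trans (ENNReal.ofReal_le_ofReal ?_)) le_rfl
        have h1 : 0 ≤ 2 * Nmax / (2 * p - 1) := by positivity
        rw [hdist1]
        push_cast
        linarith
  calc A.sampleComplexity E prior param
      ≤ ∑ H ∈ A.hypotheses, prior H * ENNReal.ofReal (A.K * (b / D + A' + a * A.L)) :=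
        Finset.sum_le_sum fun H hH => by gcongr; exact hbound H hH
    _ = ENNReal.ofReal (A.K * (b / D + A' + a * A.L)) := by
        rw [← Finset.sum_mul, hprior, one_mul]
    _ ≤ _ := by
        refine ENNReal.ofReal_le_ofReal ?_
        have h1 : (A.K : ℝ) * A' ≤ A.K * A' * A.L := le_mul_of_one_le_right (by positivity) hL'
        have h2 : (A.K : ℝ) * b / D = A.K * (b / D) := mul_div_assoc _ _ _
        rw [h2]
        nlinarith

theorem corollary2 {Θ Y : Type*} [MeasurableSpace Y] (S : HierModel Θ Y) (E : S.MLE)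
    (Δ : ℝ≥0) (hΔ : 0 < Δ) (hdist : S.Distinguishable Δ)
    (hfin : ∀ l, (S.anom l 1).Finite)
    (hleaf : ∃ V : ℝ≥0, S.MomentBound V 1 0) :
    -- reliable sample sizes of the internal tests exist, bounded uniformly in the level
    (∀ p : ℝ, p < 1 → ∀ (V : ℝ≥0) (s : ℕ), ∃ n₀ : ℕ, ∀ K l : ℕ, 1 ≤ K →
      (1 ≤ l → S.MultiDistinguishable Δ K l) → S.MomentBound V K l → (S.anom l 1).ncard ≤ s →
      ∀ n, n₀ ≤ n → HierModel.ReliableTest E K l n p) ∧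
    -- the bound on the sample complexity
    (∃ N₀min : ℕ, ∀ N₀, N₀min ≤ N₀ → ∀ (p : ℝ) (Nmax : ℕ), 1 / 2 < p →
      ∃ C B : ℝ, ∀ A : HDSParams, A.N₀ = N₀ → 1 ≤ A.L → 1 ≤ A.K → A.K ≤ 2 ^ A.L →
        0 < A.c → A.c < 1 →
        (∀ l, 1 ≤ l → l ≤ A.L → S.MultiDistinguishable Δ A.K l) →
        (∀ l, l < A.L → 1 ≤ A.N l ∧ A.N l ≤ Nmax ∧
          HierModel.ReliableTest E A.K l (A.N l) p) →
        ∀ (prior : Finset ℕ → ℝ≥0∞) (param : Finset ℕ → Finset ℕ → ℕ → ℕ → Θ) (θ₁ : Θ),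
          ∑ H ∈ A.hypotheses, prior H = 1 →
          (∀ H ∈ A.hypotheses, A.Admissible S H (param H)) →
          θ₁ ∈ S.anom 0 1 →
          (∀ H ∈ A.hypotheses, ∀ R, ∀ m ∈ H \ R,
            S.kl 0 θ₁ (S.null 0) ≤ S.kl 0 (param H R 0 m) (S.null 0)) →
          A.sampleComplexity E prior param ≤
            ENNReal.ofReal ((A.K : ℝ) * C * A.L
              + (A.K : ℝ) * Real.log ((A.L : ℝ) / A.c) / (S.kl 0 θ₁ (S.null 0)).toReal + B)) := by
  refine ⟨HierModel.exists_reliableTest E hΔ hdist hfin, ?_⟩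
  obtain ⟨V, hV⟩ := hleaf
  obtain ⟨N₀min, h⟩ := exists_sampleComplexity_bound E hΔ hdist hfin hV
  refine ⟨N₀min, fun N₀ hN₀ p Nmax hp => ?_⟩
  obtain ⟨C, hC⟩ := h N₀ hN₀ p Nmax hp
  -- The bound already holds with additive constant 0.
  refine ⟨C, 0, fun A hAN hL hK hKL hc0 hc1 _ hN prior param θ₁ hprior hadm hθ₁ hmin => ?_⟩
  rw [add_zero]
  exact hC A hAN hL hK hKL hc0 hc1 hN prior param θ₁ hprior hadm hθ₁ hmin
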